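/- Let $Q\ge 2$ be an integer and let $\mathbb{T}_Q$ be (the vertex set of) the homogeneous tree of degree $Q+1$, i.e. the connected graph without cycles in which every vertex has exactly $Q+1$ neighbours, equipped with the counting measure. Let $$\Delta f(x)=\frac{1}{Q+1}\sum_{d(y,x)=1}f(y)-f(x)$$ be the combinatorial Laplacian, where $d$ is the graph distance; $-\Delta$ is a bounded nonnegative self-adjoint operator on $\ell^2(\mathbb{T}_Q)$, and $(-\Delta)^{\alpha/2}$ and $e^{it(-\Delta)^{\alpha/2}}$ are defined by the functional calculus. Let $0<\alpha\le 2$ and $2<q,\tilde q\le\infty$, and let $q'$ be the dual exponent of $q$, $\frac1q+\frac1{q'}=1$. Then there is a constant $C>0$, depending only on $Q,\alpha,q,\tilde q$, such that for every $t\in\mathbb{R}\setminus\{0\}$ the operator $e^{it(-\Delta)^{\alpha/2}}$ maps $\ell^{q'}(\mathbb{T}_Q)\subseteq\ell^2(\mathbb{T}_Q)$ boundedly into $\ell^{\tilde q}(\mathbb{T}_Q)\supseteq\ell^2(\mathbb{T}_Q)$, with $$\bigl\|e^{it(-\Delta)^{\alpha/2}}\bigr\|_{\ell^{q'}(\mathbb{T}_Q)\to\ell^{\tilde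 q}(\mathbb{T}_Q)}\le C\,(1+|t|)^{-3/2}.$$ -/

import Mathlib

open scoped ENNReal NNReal

noncomputable section

/-- `G` is the homogeneous tree `𝕋_Q`: a connected graph without cycles in which every vertex has
exactly `Q + 1` neighbours. -/
structure IsHomogeneousTree {V : Type*} (G : SimpleGraph V) [G.LocallyFinite] (Q : ℕ) : Prop where
  isTree : G.IsTree
  regular : G.IsRegularOfDegree (Q + 1)

/-- The space `ℓ^p(V)` of complex functions on `V`, for the counting measure. -/
abbrev ellp (V : Type*) (p : ℝ≥0∞) := lp (fun _ : V => ℂ) p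

/-- The combinatorial Laplacian on functions,
`Δ f (x) = 1 / (Q + 1) * ∑_{d(y, x) = 1} f y - f x`. -/
def treeLaplacianFun {V : Type*} (G : SimpleGraph V) [G.LocallyFinite] (Q : ℕ) (f : V → ℂ) (x : V) :
    ℂ :=
  1 / ((Q : ℂ) + 1) * ∑ y ∈ G.neighborFinset x, f y - f x

section Laplacian

/-- The averaging operator over neighbours is a contraction of `ℓ²`. -/
theorem sum_norm_average_sq_le {V : Type*} {G : SimpleGraph V} [G.LocallyFinite] {Q : ℕ}
    (hG : IsHomogeneousTree G Q) (f : ellp V 2) (s : Finset V) :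
    ∑ x ∈ s, ‖1 / ((Q : ℂ) + 1) * ∑ y ∈ G.neighborFinset x, f y‖ ^ 2 ≤ ‖f‖ ^ 2 := by
  classical
  have hcard : ∀ x, (G.neighborFinset x).card = Q + 1 := fun x => hG.regular x
  have hQ : (0 : ℝ) < (Q : ℝ) + 1 := by positivity
  have hn : ‖(1 : ℂ) / ((Q : ℂ) + 1)‖ = 1 / ((Q : ℝ) + 1) := by
    have : ((Q : ℂ) + 1) = (((Q : ℝ) + 1 : ℝ) : ℂ) := by push_cast; ring
    rw [norm_div, norm_one, this, Complex.norm_real, Real.norm_of_nonneg hQ.le]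
  have h1 : ∀ x, ‖1 / ((Q : ℂ) + 1) * ∑ y ∈ G.neighborFinset x, f y‖ ^ 2 ≤
      1 / ((Q : ℝ) + 1) * ∑ y ∈ G.neighborFinset x, ‖f y‖ ^ 2 := by
    intro x
    have h2 : (∑ y ∈ G.neighborFinset x, ‖f y‖) ^ 2 ≤
        ((Q : ℝ) + 1) * ∑ y ∈ G.neighborFinset x, ‖f y‖ ^ 2 := by
      have := sq_sum_le_card_mul_sum_sq (s := G.neighborFinset x) (f := fun y => ‖f y‖)
      rw [hcard x] at this
      exact_mod_cast this
    have h3 : ‖∑ y ∈ G.neighborFinset x, f y‖ ^ 2 ≤ (∑ y ∈ G.neighborFinset x, ‖f y‖) ^ 2 := by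
      gcongr
      exact norm_sum_le _ _
    rw [norm_mul, hn, mul_pow]
    calc (1 / ((Q : ℝ) + 1)) ^ 2 * ‖∑ y ∈ G.neighborFinset x, f y‖ ^ 2
        ≤ (1 / ((Q : ℝ) + 1)) ^ 2 *
          (((Q : ℝ) + 1) * ∑ y ∈ G.neighborFinset x, ‖f y‖ ^ 2) := by
          gcongr
          exact h3.trans h2
      _ = _ := by field_simp
  set t : Finset V := s.biUnion fun x => G.neighborFinset x with ht
  have h4 : ∑ x ∈ s, ∑ y ∈ G.neighborFinset x, ‖f y‖ ^ 2 ≤ ((Q : ℝ) + 1) * ‖f‖ ^ 2 := by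
    have hswap : ∑ x ∈ s, ∑ y ∈ G.neighborFinset x, ‖f y‖ ^ 2 =
        ∑ y ∈ t, ∑ x ∈ s.filter fun x => G.Adj x y, ‖f y‖ ^ 2 := by
      refine Finset.sum_comm' fun x y => ?_
      simp only [ht, Finset.mem_biUnion, Finset.mem_filter, SimpleGraph.mem_neighborFinset]
      exact ⟨fun h => ⟨h, x, h⟩, fun h => h.1⟩
    have hnorm : ∑ y ∈ t, ‖f y‖ ^ 2 ≤ ‖f‖ ^ 2 := by
      have := lp.sum_rpow_le_norm_rpow (p := 2) (by norm_num) f t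
      simpa using this
    rw [hswap]
    calc ∑ y ∈ t, ∑ x ∈ s.filter fun x => G.Adj x y, ‖f y‖ ^ 2
        ≤ ∑ y ∈ t, ((Q : ℝ) + 1) * ‖f y‖ ^ 2 := by
          refine Finset.sum_le_sum fun y _ => ?_
          rw [Finset.sum_const, nsmul_eq_mul]
          gcongr
          have : (s.filter fun x => G.Adj x y).card ≤ (G.neighborFinset y).card := by
            refine Finset.card_le_card fun x hx => ?_
            rw [SimpleGraph.mem_neighborFinset]
            exact (Finset.mem_filter.1 hx).2.symm
          rw [hcard y] at this
          exact_mod_cast this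
      _ = ((Q : ℝ) + 1) * ∑ y ∈ t, ‖f y‖ ^ 2 := by rw [Finset.mul_sum]
      _ ≤ _ := by gcongr
  calc _ ≤ ∑ x ∈ s, 1 / ((Q : ℝ) + 1) * ∑ y ∈ G.neighborFinset x, ‖f y‖ ^ 2 :=
        Finset.sum_le_sum fun x _ => h1 x
    _ = 1 / ((Q : ℝ) + 1) * ∑ x ∈ s, ∑ y ∈ G.neighborFinset x, ‖f y‖ ^ 2 := by
        rw [Finset.mul_sum]
    _ ≤ 1 / ((Q : ℝ) + 1) * (((Q : ℝ) + 1) * ‖f‖ ^ 2) := by gcongr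
    _ = ‖f‖ ^ 2 := by field_simp

theorem memlp_average {V : Type*} {G : SimpleGraph V} [G.LocallyFinite] {Q : ℕ}
    (hG : IsHomogeneousTree G Q) (f : ellp V 2) :
    Memℓp (fun x => 1 / ((Q : ℂ) + 1) * ∑ y ∈ G.neighborFinset x, f y) 2 := by
  refine memℓp_gen' (C := ‖f‖ ^ 2) fun s => ?_
  simpa using sum_norm_average_sq_le hG f s

theorem norm_average_le {V : Type*} {G : SimpleGraph V} [G.LocallyFinite] {Q : ℕ}
    (hG : IsHomogeneousTree G Q) (f : ellp V 2) :
    ‖(⟨_, memlp_average hG f⟩ : ellp V 2)‖ ≤ ‖f‖ := by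
  refine lp.norm_le_of_forall_sum_le (by norm_num) (norm_nonneg f) fun s => ?_
  simpa using sum_norm_average_sq_le hG f s

theorem memlp_treeLaplacianFun {V : Type*} {G : SimpleGraph V} [G.LocallyFinite] {Q : ℕ}
    (hG : IsHomogeneousTree G Q) (f : ellp V 2) : Memℓp (treeLaplacianFun G Q f) 2 :=
  (memlp_average hG f).sub (lp.memℓp f)

/-- The combinatorial Laplacian `Δ` as a bounded operator on `ℓ²(𝕋_Q)`. -/
def treeLaplacian {V : Type*} {G : SimpleGraph V} [G.LocallyFinite] {Q : ℕ}
    (hG : IsHomogeneousTree G Q) : ellp V 2 →L[ℂ] ellp V 2 :=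
  LinearMap.mkContinuous
    { toFun := fun f => ⟨treeLaplacianFun G Q f, memlp_treeLaplacianFun hG f⟩
      map_add' := fun f g => by
        ext x
        simp only [treeLaplacianFun, lp.coeFn_add, Pi.add_apply, Finset.sum_add_distrib]
        ring
      map_smul' := fun c f => by
        ext x
        simp only [treeLaplacianFun, lp.coeFn_smul, Pi.smul_apply, smul_eq_mul, RingHom.id_apply,
          ← Finset.mul_sum]
        ring }
    2 fun f => by
      have hA := norm_average_le hG f
      calc _ = ‖(⟨_, memlp_average hG f⟩ : ellp V 2) - f‖ := rfl
        _ ≤ ‖(⟨_, memlp_average hG f⟩ : ellp V 2)‖ + ‖f‖ := norm_sub_le _ _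
        _ ≤ 2 * ‖f‖ := by linarith

theorem treeLaplacian_apply {V : Type*} {G : SimpleGraph V} [G.LocallyFinite] {Q : ℕ}
    (hG : IsHomogeneousTree G Q) (f : ellp V 2) (x : V) :
    treeLaplacian hG f x = 1 / ((Q : ℂ) + 1) * ∑ y ∈ G.neighborFinset x, f y - f x :=
  rfl

/-- `-Δ` is self-adjoint and nonnegative, so the functional calculus applies to it. -/
theorem neg_treeLaplacian_isPositive {V : Type*} {G : SimpleGraph V} [G.LocallyFinite] {Q : ℕ}
    (hG : IsHomogeneousTree G Q) : (-treeLaplacian hG).IsPositive := by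
  classical
  set T := -treeLaplacian hG with hT
  have hTapp : ∀ (f : ellp V 2) (x : V),
      T f x = f x - 1 / ((Q : ℂ) + 1) * ∑ y ∈ G.neighborFinset x, f y := by
    intro f x
    have : T f x = -(treeLaplacian hG f x) := rfl
    rw [this, treeLaplacian_apply]
    ring
  have hentry : ∀ i j : V, T (lp.single 2 j (1 : ℂ)) i =
      (if i = j then 1 else 0) - 1 / ((Q : ℂ) + 1) * (if G.Adj i j then 1 else 0) := by
    intro i j
    rw [hTapp]
    simp [Pi.single_apply, Finset.sum_ite_eq', SimpleGraph.mem_neighborFinset]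
  have hsa : IsSelfAdjoint T := by
    rw [ContinuousLinearMap.isSelfAdjoint_iff']
    refine lp.ext_continuousLinearMap (by norm_num) fun i => ?_
    ext j
    have h1 : ∀ g : ellp V 2, inner ℂ (lp.single 2 j (1 : ℂ)) g = g j := by
      intro g
      rw [lp.inner_single_left]
      simp
    have h2 : ∀ g : ellp V 2, inner ℂ g (lp.single 2 i (1 : ℂ)) = (starRingEnd ℂ) (g i) := by
      intro g
      rw [lp.inner_single_right]
      simp
    change (ContinuousLinearMap.adjoint T) (lp.single 2 i (1 : ℂ)) j = T (lp.single 2 i (1 : ℂ)) j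
    rw [← h1, ContinuousLinearMap.adjoint_inner_right, h2, hentry, hentry]
    simp [G.adj_comm i j, eq_comm (a := i) (b := j), apply_ite (starRingEnd ℂ)]
  rw [ContinuousLinearMap.isPositive_def']
  refine ⟨hsa, fun f => ?_⟩
  set A : ellp V 2 := ⟨_, memlp_average hG f⟩ with hAdef
  have hA : ‖A‖ ≤ ‖f‖ :=
     norm_average_le hG f
  have hTf : T f = f - A := by
    ext x
    rw [hTapp]
    rfl
  have h3 : RCLike.re (inner ℂ A f) ≤ ‖f‖ * ‖f‖ :=
    (re_inner_le_norm A f).trans (by gcongr)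
  have h4 : RCLike.re (inner ℂ f f) = ‖f‖ * ‖f‖ := by
    rw [inner_self_eq_norm_mul_norm]
  rw [ContinuousLinearMap.reApplyInnerSelf_apply, hTf, inner_sub_left, map_sub, h4]
  linarith

end Laplacian

section Hilbert

variable {H : Type*} [NormedAddCommGroup H] [InnerProductSpace ℂ H] [CompleteSpace H]

/-- The power `A ^ β` of a bounded nonnegative self-adjoint operator `A` on a Hilbert space, by the
continuous functional calculus. -/
def operatorPower (A : H →L[ℂ] H) (β : ℝ) : H →L[ℂ] H :=
  cfc (fun s : ℝ => s ^ β) A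

/-- The operator `e^{i t A}` for a bounded operator `A`, by the exponential series. -/
def unitaryGroup (A : H →L[ℂ] H) (t : ℝ) : H →L[ℂ] H :=
  NormedSpace.exp ((Complex.I * (t : ℂ)) • A)

end Hilbert

/-- The fractional Laplacian `(-Δ)^{α/2}` on `ℓ²(𝕋_Q)`. -/
def fracLaplacian {V : Type*} {G : SimpleGraph V} [G.LocallyFinite] {Q : ℕ}
    (hG : IsHomogeneousTree G Q) (α : ℝ) : ellp V 2 →L[ℂ] ellp V 2 :=
  operatorPower (-treeLaplacian hG) (α / 2)

/-- The Schrödinger group `e^{i t (-Δ)^{α/2}}` on `ℓ²(𝕋_Q)`. -/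
def schrodinger {V : Type*} {G : SimpleGraph V} [G.LocallyFinite] {Q : ℕ}
    (hG : IsHomogeneousTree G Q) (α t : ℝ) : ellp V 2 →L[ℂ] ellp V 2 :=
  unitaryGroup (fracLaplacian hG α) t

theorem norm_lp_le_of_exponent_le {V : Type*} {p r : ℝ≥0∞} [Fact (1 ≤ p)] [Fact (1 ≤ r)]
    (h : p ≤ r) (f : ellp V p) : ‖lp.linearMapOfLE ℂ (fun _ : V => ℂ) h f‖ ≤ 1 * ‖f‖ := by
  have hp1 : 1 ≤ p := Fact.out
  have hp0 : p ≠ 0 := (zero_lt_one.trans_le hp1).ne'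
  rw [one_mul]
  by_cases hr : r = ∞
  · subst hr
    exact lp.norm_le_of_forall_le (norm_nonneg f) fun x => lp.norm_apply_le_norm hp0 f x
  have hp : p ≠ ∞ := (h.trans_lt (lt_top_iff_ne_top.2 hr)).ne
  have hp' : 0 < p.toReal := ENNReal.toReal_pos hp0 hp
  have hpr : p.toReal ≤ r.toReal := ENNReal.toReal_mono hr h
  refine lp.norm_le_of_forall_sum_le (hp'.trans_le hpr) (norm_nonneg f) fun s => ?_
  have key : ∀ a : ℝ, 0 ≤ a → a ^ r.toReal = a ^ p.toReal * a ^ (r.toReal - p.toReal) := by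
    intro a ha
    rw [← Real.rpow_add_of_nonneg ha hp'.le (sub_nonneg.2 hpr)]
    congr 1
    ring
  calc ∑ x ∈ s, ‖f x‖ ^ r.toReal
      ≤ ∑ x ∈ s, ‖f x‖ ^ p.toReal * ‖f‖ ^ (r.toReal - p.toReal) := by
        refine Finset.sum_le_sum fun x _ => ?_
        rw [key _ (norm_nonneg _)]
        gcongr
        exact lp.norm_apply_le_norm hp0 f x
    _ = (∑ x ∈ s, ‖f x‖ ^ p.toReal) * ‖f‖ ^ (r.toReal - p.toReal) := by rw [Finset.sum_mul]
    _ ≤ ‖f‖ ^ p.toReal * ‖f‖ ^ (r.toReal - p.toReal) := by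
        gcongr
        exact lp.sum_rpow_le_norm_rpow hp' f s
    _ = ‖f‖ ^ r.toReal := (key _ (norm_nonneg f)).symm

/-- The inclusion `ℓ^p ⊆ ℓ^r` for `1 ≤ p ≤ r`. -/
def ellpInclusion (V : Type*) {p r : ℝ≥0∞} [Fact (1 ≤ p)] [Fact (1 ≤ r)] (h : p ≤ r) :
    ellp V p →L[ℂ] ellp V r :=
  (lp.linearMapOfLE ℂ (fun _ : V => ℂ) h).mkContinuous 1 (norm_lp_le_of_exponent_le h)

/-- The operator `e^{i t (-Δ)^{α/2}}` viewed from `ℓ^p(𝕋_Q)` to `ℓ^r(𝕋_Q)`, where `p ≤ 2 ≤ r`: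
a function in `ℓ^p ⊆ ℓ²` is sent to its image in `ℓ² ⊆ ℓ^r`. -/
def schrodingerOfLE {V : Type*} {G : SimpleGraph V} [G.LocallyFinite] {Q : ℕ}
    (hG : IsHomogeneousTree G Q) (α t : ℝ) {p r : ℝ≥0∞} [Fact (1 ≤ p)] [Fact (1 ≤ r)]
    (hp : p ≤ 2) (hr : 2 ≤ r) : ellp V p →L[ℂ] ellp V r :=
  ellpInclusion V hr ∘L schrodinger hG α t ∘L ellpInclusion V hp

/-- The dual exponent `q'` of `q > 2` satisfies `q' ≤ 2`. -/
theorem dualExponent_le_two {q q' : ℝ≥0∞} (hqq' : q.HolderConjugate q') (hq : 2 < q) :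
    q' ≤ 2 := by
  rw [← ENNReal.HolderConjugate.conjExponent_eq (p := q) (q := q') (h := hqq')]
  have h1 : (1 : ℝ≥0∞) ≤ q - 1 := by
    refine ENNReal.le_sub_of_add_le_left ENNReal.one_ne_top ?_
    rw [one_add_one_eq_two]
    exact hq.le
  calc ENNReal.conjExponent q = 1 + (q - 1)⁻¹ := rfl
    _ ≤ 1 + 1 := by gcongr; exact ENNReal.inv_le_one.2 h1
    _ = 2 := one_add_one_eq_two

end

/-! ### Oscillatory integrals with phase derivative `sin θ / p θ` -/

section Oscillatory

open MeasureTheory intervalIntegral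

variable {Ψ p : ℝ → ℝ}

/-! Let `B` be the adjacency operator divided by `2√Q`. It is self-adjoint with norm at most 1, and
`-Δ = 1 - γB` with `γ = 2√Q/(Q+1) < 1`. This spectral gap keeps `1 - γx` away from 0 on `[-1,1]`, so
the fractional power is smooth there, and the Schrödinger operator is `φ(B)` with `φ(x) =
exp(it(1-γx)^(α/2))`.

Expand `φ` in Chebyshev polynomials of the second kind, `φ(B) = Σ c_n(t) U_n(B)` entrywise
(`hasSum_chebyshevCoeff_mul`). Time and geometry then separate.

Time: with `x = cos θ`, `c_n` is the integral of `exp(itΨ(θ)) sin((n+1)θ) sin θ`, where `Ψ' = sin θ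
/ p` with `p` positive and smooth. The factor `sin θ` allows one integration by parts without
boundary terms, gaining `1/|t|`; the nondegenerate critical points `0` and `π` give a further
`|t|^(-1/2)`. Hence `|c_n| ≤ D (n+1)² (1+|t|)^(-3/2)` (`exists_norm_chebyshevCoeff_le`).

Geometry: `U_n(B)` has the nonnegative kernel `Q^(-n/2)` on pairs at distance at most `n` and of the
same parity as `n` (`aeval_U_normalizedAdjacency_single`). Its sup norm is at most `Q^(-n/2)` and
its `ℓ²` norm at most `n+1`, so interpolation gives decay geometric in `n` from `ℓ^{m'}` to `ℓ^m`
for every finite `m > 2` (`sum_chebyshevKernel_le`). This absorbs the polynomial loss in `n`.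
Different exponents `q`, `q̃` are reached by choosing `m` below both and using the inclusions
between `ℓ^p` spaces. -/

theorem hasDerivAt_cexp_phase {t θ d : ℝ} (h : HasDerivAt Ψ d θ) :
    HasDerivAt (fun s => Complex.exp (Complex.I * t * Ψ s))
      (Complex.I * t * d * Complex.exp (Complex.I * t * Ψ θ)) θ := by
  have h1 := ((h.ofReal_comp).const_mul (Complex.I * t)).cexp
  convert! h1 using 1
  ring

theorem norm_cexp_phase (t x : ℝ) : ‖Complex.exp (Complex.I * t * x)‖ = 1 := by
  have : Complex.I * t * x = ((t * x : ℝ) : ℂ) * Complex.I := by push_cast; ring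
  rw [this, Complex.norm_exp_ofReal_mul_I]

theorem continuous_cexp_phase (hΨ : Continuous Ψ) (t : ℝ) :
    Continuous fun s => Complex.exp (Complex.I * t * Ψ s) := by
  fun_prop

/-- Van der Corput type estimate for a phase with nondegenerate critical points at `0` and `π`. -/
theorem norm_integral_phase_le (hp : ∀ θ, 0 < p θ) (hpc : Continuous p)
    (hΨ : ∀ θ, HasDerivAt Ψ (Real.sin θ / p θ) θ) {u u' : ℝ → ℝ}
    (hu : ∀ θ, HasDerivAt u (u' θ) θ) (hu' : Continuous u') {M t δ : ℝ}
    (hM0 : ∀ θ ∈ Set.Icc 0 Real.pi, |u θ / p θ| ≤ M)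
    (hM1 : ∀ θ ∈ Set.Icc 0 Real.pi, |u θ| ≤ M)
    (hM2 : ∀ θ ∈ Set.Icc 0 Real.pi, |u' θ| ≤ M) (hδ : 0 < δ) (hδ1 : δ ≤ 1)
    (ht : |t| * δ ^ 2 = 1) :
    ‖∫ θ in (0 : ℝ)..Real.pi, Complex.exp (Complex.I * t * Ψ θ) * ((u θ / p θ : ℝ) : ℂ)‖
      ≤ 12 * M * δ := by
  have hpi := Real.pi_gt_three
  have hpi4 := Real.pi_lt_d2
  have hM : 0 ≤ M := (abs_nonneg _).trans (hM1 0 ⟨le_rfl, Real.pi_pos.le⟩)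
  have hΨc : Continuous Ψ := continuous_iff_continuousAt.2 fun θ => (hΨ θ).continuousAt
  have huc : Continuous u := continuous_iff_continuousAt.2 fun θ => (hu θ).continuousAt
  have hE := continuous_cexp_phase hΨc t
  set E : ℝ → ℂ := fun s => Complex.exp (Complex.I * t * Ψ s) with hEdef
  have hEn : ∀ s, ‖E s‖ = 1 := fun s => norm_cexp_phase t (Ψ s)
  set G : ℝ → ℝ := fun θ => u θ / p θ with hG
  have hGc : Continuous G := huc.div hpc fun θ => (hp θ).ne'
  set F : ℝ → ℂ := fun θ => E θ * (G θ : ℂ) with hF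
  have hFc : Continuous F := hE.mul (Complex.continuous_ofReal.comp hGc)
  have hFi : ∀ a b, IntervalIntegrable F volume a b := fun a b => hFc.intervalIntegrable a b
  have hFn : ∀ θ ∈ Set.Icc 0 Real.pi, ‖F θ‖ ≤ M := by
    intro θ hθ
    rw [hF, norm_mul, hEn, one_mul, Complex.norm_real]
    exact hM0 θ hθ
  -- Intervals of length `δ = |t|^(-1/2)` around the critical points are estimated trivially; the
  -- middle is integrated by parts.
  have hsplit : ∫ θ in (0 : ℝ)..Real.pi, F θ = (∫ θ in (0 : ℝ)..δ, F θ) +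
      (∫ θ in δ..(Real.pi - δ), F θ) + ∫ θ in (Real.pi - δ)..Real.pi, F θ := by
    rw [integral_add_adjacent_intervals (hFi _ _) (hFi _ _),
      integral_add_adjacent_intervals (hFi _ _) (hFi _ _)]
  have h1 : ‖∫ θ in (0 : ℝ)..δ, F θ‖ ≤ M * δ := by
    have := norm_integral_le_of_norm_le_const (a := 0) (b := δ) (f := F) (C := M) fun θ hθ => by
      rw [Set.uIoc_of_le hδ.le] at hθ
      exact hFn θ ⟨hθ.1.le, by linarith [hθ.2]⟩
    simpa [abs_of_pos hδ] using this
  have h3 : ‖∫ θ in (Real.pi - δ)..Real.pi, F θ‖ ≤ M * δ := by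
    have := norm_integral_le_of_norm_le_const (a := Real.pi - δ) (b := Real.pi) (f := F) (C := M)
      fun θ hθ => by
        rw [Set.uIoc_of_le (by linarith)] at hθ
        exact hFn θ ⟨by linarith [hθ.1], hθ.2⟩
    simpa [abs_of_pos hδ] using this
  have hle : δ ≤ Real.pi - δ := by linarith
  have hsin : ∀ θ ∈ Set.uIcc δ (Real.pi - δ), 0 < Real.sin θ := by
    intro θ hθ
    rw [Set.uIcc_of_le hle] at hθ
    exact Real.sin_pos_of_pos_of_lt_pi (by linarith [hθ.1]) (by linarith [hθ.2])
  have hmem : ∀ θ ∈ Set.uIcc δ (Real.pi - δ), θ ∈ Set.Icc 0 Real.pi := by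
    intro θ hθ
    rw [Set.uIcc_of_le hle] at hθ
    exact ⟨by linarith [hθ.1], by linarith [hθ.2]⟩
  -- `R` is the derivative of `u / sin`. Since `E' = it (sin / p) E`, the derivative of `E u / sin`
  -- is `it F + E R`.
  set R : ℝ → ℝ := fun θ => (u' θ * Real.sin θ - u θ * Real.cos θ) / Real.sin θ ^ 2 with hR
  have hder : ∀ θ ∈ Set.uIcc δ (Real.pi - δ), HasDerivAt
      (fun s => E s * ((u s / Real.sin s : ℝ) : ℂ))
      (Complex.I * t * F θ + E θ * (R θ : ℂ)) θ := by
    intro θ hθ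
    have hs := (hsin θ hθ).ne'
    have hp0 : (p θ : ℂ) ≠ 0 := by exact_mod_cast (hp θ).ne'
    have hs0 : (Real.sin θ : ℂ) ≠ 0 := by exact_mod_cast hs
    have := (hasDerivAt_cexp_phase (t := t) (hΨ θ)).mul
      ((hu θ).div (Real.hasDerivAt_sin θ) hs).ofReal_comp
    refine this.congr_deriv ?_
    simp only [hF, hG, hR, hEdef, Pi.div_apply]
    push_cast at hs0 ⊢
    field_simp
  have hRc : ContinuousOn R (Set.uIcc δ (Real.pi - δ)) := by
    refine ContinuousOn.div (by fun_prop) (by fun_prop) fun θ hθ => pow_ne_zero 2 (hsin θ hθ).ne'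
  have hRi : IntervalIntegrable (fun θ => E θ * (R θ : ℂ)) volume δ (Real.pi - δ) :=
    (hE.continuousOn.mul (Complex.continuous_ofReal.comp_continuousOn hRc)).intervalIntegrable
  have hFTC := integral_eq_sub_of_hasDerivAt hder (((hFi _ _).const_mul _).add hRi)
  rw [integral_add ((hFi _ _).const_mul _) hRi, intervalIntegral.integral_const_mul] at hFTC
  have hsind : 0 < Real.sin δ := hsin δ Set.left_mem_uIcc
  -- The pointwise bound `|R| ≤ 2M / sin²` integrates exactly, with primitive `-cot`.
  have hcot : ∫ θ in δ..(Real.pi - δ), 2 * M * (1 / Real.sin θ ^ 2) ≤ 4 * M / Real.sin δ := by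
    have hc : ∀ θ ∈ Set.uIcc δ (Real.pi - δ),
        HasDerivAt (fun s => -(Real.cos s / Real.sin s)) (1 / Real.sin θ ^ 2) θ := by
      intro θ hθ
      have hs := (hsin θ hθ).ne'
      refine ((Real.hasDerivAt_cos θ).div (Real.hasDerivAt_sin θ) hs).neg.congr_deriv ?_
      field_simp
      linarith [Real.sin_sq_add_cos_sq θ]
    rw [intervalIntegral.integral_const_mul, integral_eq_sub_of_hasDerivAt hc, Real.cos_pi_sub, Real.sin_pi_sub]
    · have := Real.cos_le_one δ
      rw [show 2 * M * (-(-Real.cos δ / Real.sin δ) - -(Real.cos δ / Real.sin δ)) =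
        4 * M * Real.cos δ / Real.sin δ by ring]
      exact div_le_div_of_nonneg_right (by nlinarith) hsind.le
    · refine ContinuousOn.intervalIntegrable ?_
      exact ContinuousOn.div (by fun_prop) (by fun_prop) fun θ hθ => pow_ne_zero 2 (hsin θ hθ).ne'
  have hRb : ‖∫ θ in δ..(Real.pi - δ), E θ * (R θ : ℂ)‖ ≤ 4 * M / Real.sin δ := by
    refine (norm_integral_le_of_norm_le hle ?_ ?_).trans hcot
    · refine Filter.Eventually.of_forall fun θ hθ => ?_
      have hθ' : θ ∈ Set.uIcc δ (Real.pi - δ) := by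
        rw [Set.uIcc_of_le hle]; exact ⟨hθ.1.le, hθ.2⟩
      have hs := hsin θ hθ'
      rw [norm_mul, hEn, one_mul, Complex.norm_real, Real.norm_eq_abs, hR]
      simp only
      rw [abs_div, abs_of_pos (pow_pos hs 2), mul_one_div]
      gcongr
      calc |u' θ * Real.sin θ - u θ * Real.cos θ|
          ≤ |u' θ * Real.sin θ| + |u θ * Real.cos θ| := abs_sub _ _
        _ = |u' θ| * |Real.sin θ| + |u θ| * |Real.cos θ| := by rw [abs_mul, abs_mul]
        _ ≤ M * 1 + M * 1 := by
          gcongr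
          · exact hM2 θ (hmem θ hθ')
          · exact Real.abs_sin_le_one θ
          · exact hM1 θ (hmem θ hθ')
          · exact Real.abs_cos_le_one θ
        _ = 2 * M := by ring
    · refine ContinuousOn.intervalIntegrable ?_
      exact continuousOn_const.mul (ContinuousOn.div (by fun_prop) (by fun_prop)
        fun θ hθ => pow_ne_zero 2 (hsin θ hθ).ne')
  have hb : ∀ θ ∈ Set.uIcc δ (Real.pi - δ), Real.sin θ = Real.sin δ →
      ‖E θ * ((u θ / Real.sin θ : ℝ) : ℂ)‖ ≤ M / Real.sin δ := by
    intro θ hθ hs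
    rw [norm_mul, hEn, one_mul, Complex.norm_real, Real.norm_eq_abs, hs, abs_div,
      abs_of_pos hsind]
    gcongr
    exact hM1 θ (hmem θ hθ)
  have hmid : |t| * ‖∫ θ in δ..(Real.pi - δ), F θ‖ ≤ 6 * M / Real.sin δ := by
    have h2 : Complex.I * t * ∫ θ in δ..(Real.pi - δ), F θ = _ := eq_sub_of_add_eq hFTC
    have h4 : ‖Complex.I * t * ∫ θ in δ..(Real.pi - δ), F θ‖ =
        |t| * ‖∫ θ in δ..(Real.pi - δ), F θ‖ := by
      simp
    rw [← h4, h2]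
    refine (norm_sub_le _ _).trans ?_
    have := norm_sub_le (E (Real.pi - δ) * ((u (Real.pi - δ) / Real.sin (Real.pi - δ) : ℝ) : ℂ))
      (E δ * ((u δ / Real.sin δ : ℝ) : ℂ))
    have e1 := hb _ Set.right_mem_uIcc (Real.sin_pi_sub δ)
    have e2 := hb _ Set.left_mem_uIcc rfl
    calc _ ≤ (M / Real.sin δ + M / Real.sin δ) + 4 * M / Real.sin δ := by linarith
      _ = _ := by ring
  -- Jordan's inequality gives `sin δ ≥ 0.6 δ`, turning 6 into 10; the two end intervals add 1 each,
  -- for a total of 12.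
  have hjordan : 2 / Real.pi * δ ≤ Real.sin δ := Real.mul_le_sin hδ.le (by linarith)
  have hmid' : ‖∫ θ in δ..(Real.pi - δ), F θ‖ ≤ 10 * M * δ := by
    have h5 : 6 * M / Real.sin δ ≤ 10 * M / δ := by
      rw [div_le_div_iff₀ hsind hδ]
      have : 6 * δ ≤ 10 * Real.sin δ := by
        have h6 : 2 / Real.pi ≥ 0.6 := by
          rw [ge_iff_le, le_div_iff₀ Real.pi_pos]; linarith
        nlinarith
      nlinarith
    have h7 := hmid.trans h5
    rw [le_div_iff₀ hδ] at h7
    calc ‖∫ θ in δ..(Real.pi - δ), F θ‖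
        = (|t| * ‖∫ θ in δ..(Real.pi - δ), F θ‖ * δ) * δ := by
          linear_combination (-‖∫ θ in δ..(Real.pi - δ), F θ‖) * ht
      _ ≤ 10 * M * δ := by gcongr
  rw [hsplit]
  refine (norm_add_le _ _).trans ?_
  have := norm_add_le (∫ θ in (0 : ℝ)..δ, F θ) (∫ θ in δ..(Real.pi - δ), F θ)
  linarith

theorem exists_bound_of_contDiff (hp : ContDiff ℝ 2 p) (a b : ℝ) : ∃ M, 1 ≤ M ∧
    ∀ θ ∈ Set.Icc a b, |p θ| ≤ M ∧ |deriv p θ| ≤ M ∧ |deriv (deriv p) θ| ≤ M := by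
  have h1 : ContDiff ℝ 1 (deriv p) := ((contDiff_succ_iff_deriv (n := 1)).1 hp).2.2
  have h2 : Continuous (deriv (deriv p)) := h1.continuous_deriv le_rfl
  obtain ⟨A, hA⟩ := isCompact_Icc.exists_bound_of_continuousOn (s := Set.Icc a b)
    hp.continuous.continuousOn
  obtain ⟨B, hB⟩ := isCompact_Icc.exists_bound_of_continuousOn (s := Set.Icc a b)
    h1.continuous.continuousOn
  obtain ⟨C, hC⟩ := isCompact_Icc.exists_bound_of_continuousOn (s := Set.Icc a b)
    h2.continuousOn
  refine ⟨max 1 (max A (max B C)), le_max_left _ _, fun θ hθ => ⟨?_, ?_, ?_⟩⟩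
  · exact (hA θ hθ).trans (by simp)
  · exact (hB θ hθ).trans (by simp)
  · exact (hC θ hθ).trans (by simp)

theorem abs_lin3_le {a b c x y z A B C X : ℝ} (ha : |a| ≤ A) (hb : |b| ≤ B) (hc : |c| ≤ C)
    (hx : |x| ≤ X) (hy : |y| ≤ X) (hz : |z| ≤ X) :
    |a * x + b * y + c * z| ≤ (A + B + C) * X := by
  have hA := (abs_nonneg _).trans ha
  have hB := (abs_nonneg _).trans hb
  have hC := (abs_nonneg _).trans hc
  calc |a * x + b * y + c * z| ≤ |a * x + b * y| + |c * z| := abs_add_le _ _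
    _ ≤ |a * x| + |b * y| + |c * z| := by gcongr; exact abs_add_le _ _
    _ = |a| * |x| + |b| * |y| + |c| * |z| := by simp only [abs_mul]
    _ ≤ A * X + B * X + C * X := by gcongr
    _ = _ := by ring

/-- Decay of the Fourier sine coefficients of `e^{itΨ} sin`, with polynomial loss in the
frequency. -/
theorem exists_norm_integral_phase_sin_le (hp : ∀ θ, 0 < p θ) (hpc : ContDiff ℝ 2 p)
    (hΨ : ∀ θ, HasDerivAt Ψ (Real.sin θ / p θ) θ) :
    ∃ D : ℝ, 0 < D ∧ ∀ (n : ℕ) (t : ℝ),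
      ‖∫ θ in (0 : ℝ)..Real.pi, Complex.exp (Complex.I * t * Ψ θ) *
        ((Real.sin ((n + 1) * θ) * Real.sin θ : ℝ) : ℂ)‖ ≤
          D * (n + 1) ^ 2 * (1 + |t|) ^ (-(3 / 2) : ℝ) := by
  obtain ⟨M, hM1, hM⟩ := exists_bound_of_contDiff hpc 0 Real.pi
  have hM0 : 0 ≤ M := zero_le_one.trans hM1
  have hdp : ContDiff ℝ 1 (deriv p) := ((contDiff_succ_iff_deriv (n := 1)).1 hpc).2.2
  have hddp : Continuous (deriv (deriv p)) := hdp.continuous_deriv le_rfl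
  have hpd : ∀ θ, HasDerivAt p (deriv p θ) θ := fun θ =>
    ((hpc.differentiable (by norm_num)) θ).hasDerivAt
  have hpdd : ∀ θ, HasDerivAt (deriv p) (deriv (deriv p) θ) θ := fun θ =>
    ((hdp.differentiable (by norm_num)) θ).hasDerivAt
  have hΨc : Continuous Ψ := continuous_iff_continuousAt.2 fun θ => (hΨ θ).continuousAt
  -- `384 = 12 · 8 · 4`: 12 from the van der Corput bound, 8 from the bounds on its amplitude, 4
  -- from replacing `|t|` by `1 + |t|`.
  refine ⟨384 * M ^ 2, by positivity, fun n t => ?_⟩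
  set N : ℝ := (n : ℝ) + 1 with hN
  have hN1 : 1 ≤ N := by rw [hN]; linarith [n.cast_nonneg (α := ℝ)]
  have hN0 : 0 ≤ N := zero_le_one.trans hN1
  set E : ℝ → ℂ := fun s => Complex.exp (Complex.I * t * Ψ s) with hEdef
  have hEn : ∀ s, ‖E s‖ = 1 := fun s => norm_cexp_phase t (Ψ s)
  have hE : Continuous E := continuous_cexp_phase hΨc t
  set J : ℂ := ∫ θ in (0 : ℝ)..Real.pi, E θ * ((Real.sin (N * θ) * Real.sin θ : ℝ) : ℂ) with hJ
  change ‖J‖ ≤ _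
  have hpi4 := Real.pi_lt_d2
  have hJ4 : ‖J‖ ≤ 4 := by
    have := norm_integral_le_of_norm_le_const (a := 0) (b := Real.pi) (C := 1)
      (f := fun θ => E θ * ((Real.sin (N * θ) * Real.sin θ : ℝ) : ℂ)) fun θ _ => by
        rw [norm_mul, hEn, one_mul, Complex.norm_real, norm_mul]
        exact mul_le_one₀ (Real.abs_sin_le_one _) (norm_nonneg _) (Real.abs_sin_le_one _)
    refine this.trans ?_
    rw [sub_zero, abs_of_pos Real.pi_pos]
    linarith
  rcases le_total |t| 1 with ht1 | ht1
  -- For `|t| ≤ 1` the trivial bound on `J` suffices.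
  · have h1 : (1 / 4 : ℝ) ≤ (1 + |t|) ^ (-(3 / 2) : ℝ) := by
      calc (1 / 4 : ℝ) = (2 : ℝ) ^ (-2 : ℝ) := by
            rw [Real.rpow_neg (by norm_num)]; norm_num
        _ ≤ (2 : ℝ) ^ (-(3 / 2) : ℝ) := Real.rpow_le_rpow_of_exponent_le (by norm_num) (by norm_num)
        _ ≤ (1 + |t|) ^ (-(3 / 2) : ℝ) := by
            refine Real.rpow_le_rpow_of_nonpos (by positivity) (by linarith) (by norm_num)
    have h2 : (1 : ℝ) ≤ M ^ 2 * N ^ 2 := by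
      have := one_le_pow₀ hM1 (n := 2)
      have := one_le_pow₀ hN1 (n := 2)
      nlinarith
    calc ‖J‖ ≤ 4 := hJ4
      _ ≤ 384 * (M ^ 2 * N ^ 2) * (1 / 4) := by linarith
      _ ≤ 384 * (M ^ 2 * N ^ 2) * (1 + |t|) ^ (-(3 / 2) : ℝ) := by gcongr
      _ = _ := by ring
  have ht0 : 0 < |t| := by linarith
  set δ : ℝ := |t| ^ (-(1 / 2) : ℝ) with hδ
  have hδ0 : 0 < δ := Real.rpow_pos_of_pos ht0 _
  have hδ1 : δ ≤ 1 := Real.rpow_le_one_of_one_le_of_nonpos ht1 (by norm_num)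
  have htδ : |t| * δ ^ 2 = 1 := by
    rw [hδ, ← Real.rpow_natCast, ← Real.rpow_mul ht0.le]
    norm_num
    rw [Real.rpow_neg_one, mul_inv_cancel₀ ht0.ne']
  have hδ3 : δ ^ 3 ≤ 4 * (1 + |t|) ^ (-(3 / 2) : ℝ) := by
    have e1 : δ ^ 3 = |t| ^ (-(3 / 2) : ℝ) := by
      rw [hδ, ← Real.rpow_natCast, ← Real.rpow_mul ht0.le]
      norm_num
    have e2 : (2 * |t|) ^ (-(3 / 2) : ℝ) ≤ (1 + |t|) ^ (-(3 / 2) : ℝ) :=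
      Real.rpow_le_rpow_of_nonpos (by positivity) (by linarith) (by norm_num)
    rw [Real.mul_rpow (by norm_num) ht0.le] at e2
    have e3 : (1 / 4 : ℝ) ≤ (2 : ℝ) ^ (-(3 / 2) : ℝ) := by
      calc (1 / 4 : ℝ) = (2 : ℝ) ^ (-2 : ℝ) := by
            rw [Real.rpow_neg (by norm_num)]; norm_num
        _ ≤ _ := Real.rpow_le_rpow_of_exponent_le (by norm_num) (by norm_num)
    have e4 : 0 ≤ |t| ^ (-(3 / 2) : ℝ) := by positivity
    rw [e1]
    nlinarith
  have hcosN : ∀ θ, HasDerivAt (fun s => Real.cos (N * s)) (-(N * Real.sin (N * θ))) θ := by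
    intro θ
    refine ((Real.hasDerivAt_cos (N * θ)).comp θ ((hasDerivAt_id θ).const_mul N)).congr_deriv ?_
    ring
  have hsinN : ∀ θ, HasDerivAt (fun s => Real.sin (N * s)) (N * Real.cos (N * θ)) θ := by
    intro θ
    refine ((Real.hasDerivAt_sin (N * θ)).comp θ ((hasDerivAt_id θ).const_mul N)).congr_deriv ?_
    ring
  -- `A` is the derivative of `sin(Nθ) p(θ)`, the amplitude left by the first integration by parts.
  set A : ℝ → ℝ := fun θ => N * Real.cos (N * θ) * p θ + Real.sin (N * θ) * deriv p θ with hA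
  set A' : ℝ → ℝ := fun θ => (-(N ^ 2 * Real.sin (N * θ))) * p θ +
    (2 * N * Real.cos (N * θ)) * deriv p θ + Real.sin (N * θ) * deriv (deriv p) θ with hA'
  have hAd : ∀ θ, HasDerivAt A (A' θ) θ := by
    intro θ
    refine ((((hcosN θ).const_mul N).mul (hpd θ)).add ((hsinN θ).mul (hpdd θ))).congr_deriv ?_
    simp only [hA']
    ring
  have hAc : Continuous A := continuous_iff_continuousAt.2 fun θ => (hAd θ).continuousAt
  have hA'c : Continuous A' := by
    have := hpc.continuous
    have := hdp.continuous
    fun_prop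
  have hsq : N ≤ N ^ 2 := by nlinarith
  have hNs : ∀ θ, |N * Real.cos (N * θ)| ≤ N := fun θ => by
    rw [abs_mul, abs_of_nonneg hN0]
    exact mul_le_of_le_one_right hN0 (Real.abs_cos_le_one _)
  have hAb : ∀ θ ∈ Set.Icc 0 Real.pi, |A θ| ≤ 4 * N ^ 2 * M := by
    intro θ hθ
    obtain ⟨m0, m1, -⟩ := hM θ hθ
    have := abs_lin3_le (hNs θ) (Real.abs_sin_le_one (N * θ)) (abs_zero.le : |(0 : ℝ)| ≤ 0)
      m0 m1 m1
    rw [zero_mul, add_zero] at this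
    refine this.trans ?_
    gcongr
    nlinarith
  have hA'b : ∀ θ ∈ Set.Icc 0 Real.pi, |A' θ| ≤ 4 * N ^ 2 * M := by
    intro θ hθ
    obtain ⟨m0, m1, m2⟩ := hM θ hθ
    have h1 : |-(N ^ 2 * Real.sin (N * θ))| ≤ N ^ 2 := by
      rw [abs_neg, abs_mul, abs_of_nonneg (sq_nonneg N)]
      exact mul_le_of_le_one_right (sq_nonneg N) (Real.abs_sin_le_one _)
    have h2 : |2 * N * Real.cos (N * θ)| ≤ 2 * N := by
      rw [mul_assoc, abs_mul, abs_two]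
      linarith [hNs θ]
    refine (abs_lin3_le h1 h2 (Real.abs_sin_le_one (N * θ)) m0 m1 m2).trans ?_
    gcongr
    nlinarith
  -- Taking `u = A p` makes the amplitude `u / p` equal to `A`. The constant comes from `|A|, |A'| ≤
  -- 4N²M` and `|p|, |p'| ≤ M`, with two terms in `u'`.
  have hK := norm_integral_phase_le (t := t) (δ := δ) (M := 8 * N ^ 2 * M ^ 2) hp hpc.continuous hΨ
    (u := fun θ => A θ * p θ) (u' := fun θ => A' θ * p θ + A θ * deriv p θ)
    (fun θ => (hAd θ).mul (hpd θ))
    ((hA'c.mul hpc.continuous).add (hAc.mul hdp.continuous))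
    (fun θ hθ => by
      rw [mul_div_cancel_right₀ _ (hp θ).ne']
      refine (hAb θ hθ).trans ?_
      have : M ≤ M ^ 2 := by nlinarith
      have h3 : N ^ 2 * M ≤ N ^ 2 * M ^ 2 := by gcongr
      have h4 : 0 ≤ N ^ 2 * M := by positivity
      nlinarith)
    (fun θ hθ => by
      rw [abs_mul]
      calc |A θ| * |p θ| ≤ (4 * N ^ 2 * M) * M := by
            gcongr
            · exact hAb θ hθ
            · exact (hM θ hθ).1
        _ ≤ _ := by nlinarith [sq_nonneg (N * M)])
    (fun θ hθ => by
      calc |A' θ * p θ + A θ * deriv p θ| ≤ |A' θ * p θ| + |A θ * deriv p θ| := abs_add_le _ _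
        _ = |A' θ| * |p θ| + |A θ| * |deriv p θ| := by simp only [abs_mul]
        _ ≤ (4 * N ^ 2 * M) * M + (4 * N ^ 2 * M) * M := by
            gcongr
            · exact hA'b θ hθ
            · exact (hM θ hθ).1
            · exact hAb θ hθ
            · exact (hM θ hθ).2.1
        _ = _ := by ring)
    hδ0 hδ1 htδ
  have hsimp : ∀ θ, A θ * p θ / p θ = A θ := fun θ => mul_div_cancel_right₀ _ (hp θ).ne'
  simp only [hsimp] at hK
  have hder : ∀ θ ∈ Set.uIcc 0 Real.pi, HasDerivAt
      (fun s => E s * ((Real.sin (N * s) * p s : ℝ) : ℂ))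
      (Complex.I * t * (E θ * ((Real.sin (N * θ) * Real.sin θ : ℝ) : ℂ)) + E θ * (A θ : ℂ)) θ := by
    intro θ _
    have hp0 : (p θ : ℂ) ≠ 0 := by exact_mod_cast (hp θ).ne'
    refine ((hasDerivAt_cexp_phase (t := t) (hΨ θ)).mul
      ((hsinN θ).mul (hpd θ)).ofReal_comp).congr_deriv ?_
    simp only [hEdef, hA, Pi.mul_apply]
    push_cast
    field_simp
  have hi1 : IntervalIntegrable (fun θ => E θ * ((Real.sin (N * θ) * Real.sin θ : ℝ) : ℂ))
      volume 0 Real.pi := by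
    refine Continuous.intervalIntegrable ?_ _ _
    exact hE.mul (Complex.continuous_ofReal.comp (by fun_prop))
  have hi2 : IntervalIntegrable (fun θ => E θ * (A θ : ℂ)) volume 0 Real.pi :=
    (hE.mul (Complex.continuous_ofReal.comp hAc)).intervalIntegrable _ _
  have hFTC := integral_eq_sub_of_hasDerivAt hder ((hi1.const_mul _).add hi2)
  rw [integral_add (hi1.const_mul _) hi2, intervalIntegral.integral_const_mul] at hFTC
  -- `N` is an integer, so the boundary terms vanish at both ends and the full factor `1/|t|` is
  -- gained.
  have hend : Real.sin (N * Real.pi) = 0 := by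
    rw [hN]
    exact_mod_cast Real.sin_nat_mul_pi (n + 1)
  simp only [hend, mul_zero, Real.sin_zero, zero_mul, Complex.ofReal_zero, sub_zero] at hFTC
  have htJ : |t| * ‖J‖ ≤ 12 * (8 * N ^ 2 * M ^ 2) * δ := by
    have h1 : ‖Complex.I * t * J‖ = |t| * ‖J‖ := by simp
    rw [← h1, eq_neg_of_add_eq_zero_left hFTC, norm_neg]
    exact hK
  calc ‖J‖ = (|t| * ‖J‖) * δ ^ 2 := by linear_combination (-‖J‖) * htδ
    _ ≤ (12 * (8 * N ^ 2 * M ^ 2) * δ) * δ ^ 2 := by gcongr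
    _ = 96 * M ^ 2 * N ^ 2 * δ ^ 3 := by ring
    _ ≤ 96 * M ^ 2 * N ^ 2 * (4 * (1 + |t|) ^ (-(3 / 2) : ℝ)) := by gcongr
    _ = _ := by ring

end Oscillatory

/-! ### Chebyshev expansion of the functional calculus -/

section Chebyshev

open MeasureTheory intervalIntegral Polynomial
open Polynomial.Chebyshev (U complex_ofReal_eval_U U_real_cos U_add_one)

/-- The coefficient of `f` along the Chebyshev polynomial of the second kind `U n`. -/
noncomputable def chebyshevCoeff (f : ℝ → ℂ) (n : ℕ) : ℂ :=
  2 / Real.pi * ∫ θ in (0 : ℝ)..Real.pi,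
    f (Real.cos θ) * ((Real.sin ((n + 1) * θ) * Real.sin θ : ℝ) : ℂ)

theorem continuous_comp_cos {f : ℝ → ℂ} (hf : ContinuousOn f (Set.Icc (-1) 1)) :
    Continuous fun θ => f (Real.cos θ) :=
  hf.comp_continuous Real.continuous_cos Real.cos_mem_Icc

theorem intervalIntegrable_chebyshevCoeff {f : ℝ → ℂ} (hf : ContinuousOn f (Set.Icc (-1) 1))
    (n : ℕ) (a b : ℝ) : IntervalIntegrable
      (fun θ => f (Real.cos θ) * ((Real.sin ((n + 1) * θ) * Real.sin θ : ℝ) : ℂ)) volume a b := by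
  refine Continuous.intervalIntegrable ?_ a b
  exact (continuous_comp_cos hf).mul (Complex.continuous_ofReal.comp (by fun_prop))

theorem chebyshevCoeff_add {f g : ℝ → ℂ} (hf : ContinuousOn f (Set.Icc (-1) 1))
    (hg : ContinuousOn g (Set.Icc (-1) 1)) (n : ℕ) :
    chebyshevCoeff (fun x => f x + g x) n = chebyshevCoeff f n + chebyshevCoeff g n := by
  simp only [chebyshevCoeff]
  rw [← mul_add, ← intervalIntegral.integral_add (intervalIntegrable_chebyshevCoeff hf n _ _)
    (intervalIntegrable_chebyshevCoeff hg n _ _)]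
  simp only [← add_mul]

theorem chebyshevCoeff_const_mul (c : ℂ) (f : ℝ → ℂ) (n : ℕ) :
    chebyshevCoeff (fun x => c * f x) n = c * chebyshevCoeff f n := by
  simp only [chebyshevCoeff, mul_assoc, intervalIntegral.integral_const_mul]
  ring

theorem norm_chebyshevCoeff_le {f : ℝ → ℂ} {ε : ℝ} (hf : ∀ x ∈ Set.Icc (-1 : ℝ) 1, ‖f x‖ ≤ ε)
    (n : ℕ) : ‖chebyshevCoeff f n‖ ≤ 2 * ε := by
  have hε : 0 ≤ ε := (norm_nonneg _).trans (hf 0 (by simp))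
  have := norm_integral_le_of_norm_le_const (a := 0) (b := Real.pi) (C := ε)
    (f := fun θ => f (Real.cos θ) * ((Real.sin ((n + 1) * θ) * Real.sin θ : ℝ) : ℂ))
    fun θ _ => by
      rw [norm_mul, Complex.norm_real, norm_mul]
      exact (mul_le_of_le_one_right (norm_nonneg _) (mul_le_one₀ (Real.abs_sin_le_one _)
        (norm_nonneg _) (Real.abs_sin_le_one _))).trans (hf _ (Real.cos_mem_Icc θ))
  rw [sub_zero, abs_of_pos Real.pi_pos] at this
  have hn : ‖(2 / Real.pi : ℂ)‖ = 2 / Real.pi := by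
    rw [norm_div, Complex.norm_real, Real.norm_of_nonneg Real.pi_pos.le]
    simp
  rw [chebyshevCoeff, norm_mul, hn]
  calc _ ≤ 2 / Real.pi * (ε * Real.pi) := by gcongr
    _ = 2 * ε := by field_simp

theorem integral_cos_int_mul (k : ℤ) :
    ∫ θ in (0 : ℝ)..Real.pi, Real.cos (k * θ) = if k = 0 then Real.pi else 0 := by
  split_ifs with h
  · simp [h]
  · have hk : (k : ℝ) ≠ 0 := by exact_mod_cast h
    rw [intervalIntegral.integral_comp_mul_left (fun x => Real.cos x) hk, integral_cos]
    simp [Real.sin_int_mul_pi]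

/-- As `U_m(cos θ) sin θ = sin((m+1)θ)`, this is the orthogonality of sines on `[0, π]`. -/
theorem chebyshevCoeff_U (m n : ℕ) :
    chebyshevCoeff (fun x => (U ℂ m).eval (x : ℂ)) n = if n = m then 1 else 0 := by
  have h1 : ∀ θ : ℝ, (U ℂ m).eval ((Real.cos θ : ℝ) : ℂ) *
      ((Real.sin ((n + 1) * θ) * Real.sin θ : ℝ) : ℂ) =
      ((1 / 2 * (Real.cos (((m - n : ℤ) : ℝ) * θ) - Real.cos (((m + n + 2 : ℤ) : ℝ) * θ)) : ℝ) :
        ℂ) := by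
    intro θ
    rw [← complex_ofReal_eval_U, ← Complex.ofReal_mul]
    congr 1
    have h2 := U_real_cos θ m
    have h3 : ((m - n : ℤ) : ℝ) * θ = (m + 1) * θ - (n + 1) * θ := by push_cast; ring
    have h4 : ((m + n + 2 : ℤ) : ℝ) * θ = (m + 1) * θ + (n + 1) * θ := by push_cast; ring
    rw [h3, h4, Real.cos_sub, Real.cos_add]
    push_cast at h2
    linear_combination Real.sin ((n + 1) * θ) * h2
  rw [chebyshevCoeff]
  simp only [h1]
  rw [intervalIntegral.integral_ofReal, intervalIntegral.integral_const_mul,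
    intervalIntegral.integral_sub (by exact Continuous.intervalIntegrable (by fun_prop) _ _)
      (by exact Continuous.intervalIntegrable (by fun_prop) _ _),
    integral_cos_int_mul, integral_cos_int_mul, if_neg (by positivity : (m + n + 2 : ℤ) ≠ 0)]
  have hpi : (Real.pi : ℂ) ≠ 0 := by exact_mod_cast Real.pi_ne_zero
  by_cases h : n = m
  · subst h
    simp
    field_simp
  · rw [if_neg h, if_neg (by omega)]
    simp

theorem X_mul_U_eq (n : ℕ) :
    (X : ℂ[X]) * U ℂ n = (1 / 2 : ℂ) • (U ℂ (n + 1) + U ℂ (n - 1)) := by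
  rw [U_add_one, sub_add_cancel, mul_assoc, smul_eq_C_mul, ← mul_assoc, ← mul_assoc]
  congr 1
  have h : (C (1 / 2 : ℂ)) * 2 = 1 := by
    rw [show (2 : ℂ[X]) = C 2 from rfl, ← C_mul]
    norm_num
  rw [h, one_mul]

/-- The span contains `U_0 = 1` and, by the three-term recurrence, is stable under multiplication by
`X`. -/
theorem span_range_U : Submodule.span ℂ (Set.range fun n : ℕ => U ℂ n) = ⊤ := by
  set S := Submodule.span ℂ (Set.range fun n : ℕ => U ℂ n) with hS
  have hU : ∀ n : ℕ, U ℂ n ∈ S := fun n => Submodule.subset_span ⟨n, rfl⟩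
  have hX : ∀ p ∈ S, X * p ∈ S := by
    intro p hp
    refine Submodule.span_induction (p := fun q _ => X * q ∈ S) ?_ ?_ ?_ ?_ hp
    · rintro _ ⟨n, rfl⟩
      simp only
      rw [X_mul_U_eq]
      refine S.smul_mem _ (S.add_mem (by exact_mod_cast hU (n + 1)) ?_)
      -- For `n = 0` the lower neighbour is `U_{-1} = 0`.
      rcases n with _ | n
      · simp
      · simpa using hU n
    · simp
    · intro x y _ _ hx hy
      rw [mul_add]
      exact S.add_mem hx hy
    · intro c x _ hx
      rw [mul_smul_comm]
      exact S.smul_mem _ hx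
  have hpow : ∀ k : ℕ, (X : ℂ[X]) ^ k ∈ S := by
    intro k
    induction k with
    | zero => simpa using hU 0
    | succ k ih => rw [pow_succ']; exact hX _ ih
  rw [eq_top_iff]
  intro p _
  induction p using Polynomial.induction_on' with
  | add p q hp hq => exact S.add_mem (hp trivial) (hq trivial)
  | monomial n a => rw [← C_mul_X_pow_eq_monomial, ← smul_eq_C_mul]; exact S.smul_mem _ (hpow n)

theorem abs_sin_nat_mul_le (n : ℕ) (θ : ℝ) : |Real.sin (n * θ)| ≤ n * |Real.sin θ| := by
  induction n with
  | zero => simp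
  | succ n ih =>
    push_cast
    rw [add_mul, one_mul, Real.sin_add]
    refine (abs_add_le _ _).trans ?_
    rw [abs_mul, abs_mul, add_mul, one_mul]
    exact add_le_add ((mul_le_of_le_one_right (abs_nonneg _) (Real.abs_cos_le_one _)).trans ih)
      (mul_le_of_le_one_left (abs_nonneg _) (Real.abs_cos_le_one _))

/-- With `x = cos θ`, divide `|sin((n+1)θ)| ≤ (n+1)|sin θ|` by `sin θ`. This needs `|x| < 1`; the
endpoints follow by continuity. -/
theorem abs_U_eval_le (n : ℕ) {x : ℝ} (hx : x ∈ Set.Icc (-1 : ℝ) 1) :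
    |(U ℝ n).eval x| ≤ n + 1 := by
  have hop : ∀ y ∈ Set.Ioo (-1 : ℝ) 1, |(U ℝ n).eval y| ≤ n + 1 := by
    intro y hy
    have hs : 0 < Real.sin (Real.arccos y) := by
      rw [Real.sin_arccos]
      exact Real.sqrt_pos.2 (by nlinarith [hy.1, hy.2])
    have h1 := U_real_cos (Real.arccos y) n
    rw [Real.cos_arccos hy.1.le hy.2.le] at h1
    have h2 := abs_sin_nat_mul_le (n + 1) (Real.arccos y)
    push_cast at h1 h2
    rw [← h1, abs_mul] at h2
    exact le_of_mul_le_mul_right h2 (abs_pos.2 hs.ne')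
  have hcl : IsClosed {y : ℝ | |(U ℝ n).eval y| ≤ n + 1} :=
    isClosed_le (by fun_prop) continuous_const
  have : closure (Set.Ioo (-1 : ℝ) 1) ⊆ {y : ℝ | |(U ℝ n).eval y| ≤ n + 1} :=
    hcl.closure_subset_iff.2 hop
  rw [closure_Ioo (by norm_num)] at this
  exact this hx

theorem exists_complex_polynomial_near {f : ℝ → ℂ} (hf : ContinuousOn f (Set.Icc (-1) 1)) {ε : ℝ}
    (hε : 0 < ε) : ∃ P : ℂ[X], ∀ x ∈ Set.Icc (-1 : ℝ) 1, ‖P.eval (x : ℂ) - f x‖ ≤ ε := by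
  obtain ⟨p, hp⟩ := exists_polynomial_near_of_continuousOn (-1) 1 (fun x => (f x).re)
    (Complex.continuous_re.comp_continuousOn hf) (ε / 2) (half_pos hε)
  obtain ⟨q, hq⟩ := exists_polynomial_near_of_continuousOn (-1) 1 (fun x => (f x).im)
    (Complex.continuous_im.comp_continuousOn hf) (ε / 2) (half_pos hε)
  refine ⟨p.map Complex.ofRealHom + C Complex.I * q.map Complex.ofRealHom, fun x hx => ?_⟩
  have e : ∀ r : ℝ[X], (r.map Complex.ofRealHom).eval (x : ℂ) = ((r.eval x : ℝ) : ℂ) := fun r => by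
    rw [eval_map, ← Complex.ofRealHom_eq_coe, eval₂_at_apply, Complex.ofRealHom_eq_coe]
  refine (Complex.norm_le_abs_re_add_abs_im _).trans ?_
  have h1 := hp x hx
  have h2 := hq x hx
  simp [e]
  linarith

variable {H : Type*} [NormedAddCommGroup H] [InnerProductSpace ℂ H] [CompleteSpace H]

theorem spectrum_re_mem_Icc {B : H →L[ℂ] H} (hB : IsSelfAdjoint B) (hB1 : ‖B‖ ≤ 1) {z : ℂ}
    (hz : z ∈ spectrum ℂ B) : z = z.re ∧ z.re ∈ Set.Icc (-1 : ℝ) 1 := by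
  refine ⟨hB.mem_spectrum_eq_re hz, ?_⟩
  have h1 : ‖z‖ ≤ ‖B‖ * ‖(1 : H →L[ℂ] H)‖ := spectrum.norm_le_norm_mul_of_mem hz
  have h2 : ‖(1 : H →L[ℂ] H)‖ ≤ 1 := ContinuousLinearMap.norm_id_le
  have h3 : ‖z‖ ≤ 1 := h1.trans (mul_le_one₀ hB1 (norm_nonneg _) h2)
  exact abs_le.1 ((Complex.abs_re_le_norm z).trans h3)

/-- The spectrum lies in `[-1,1]`, where `|U_n| ≤ n + 1`. This is the `ℓ²` endpoint of the later
interpolation. -/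
theorem norm_aeval_U_le {B : H →L[ℂ] H} (hB : IsSelfAdjoint B) (hB1 : ‖B‖ ≤ 1) (n : ℕ) :
    ‖aeval B (U ℂ n)‖ ≤ n + 1 := by
  rw [← cfc_polynomial _ B hB.isStarNormal]
  refine norm_cfc_le (by positivity) fun z hz => ?_
  obtain ⟨h1, h2⟩ := spectrum_re_mem_Icc hB hB1 hz
  rw [h1, ← complex_ofReal_eval_U, Complex.norm_real]
  exact abs_U_eval_le n h2

theorem norm_cfc_sub_aeval_le {B : H →L[ℂ] H} (hB : IsSelfAdjoint B) (hB1 : ‖B‖ ≤ 1) {f : ℝ → ℂ}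
    (hf : ContinuousOn f (Set.Icc (-1) 1)) {P : ℂ[X]} {ε : ℝ} (hε : 0 ≤ ε)
    (h : ∀ x ∈ Set.Icc (-1 : ℝ) 1, ‖P.eval (x : ℂ) - f x‖ ≤ ε) :
    ‖aeval B P - cfc (fun z : ℂ => f z.re) B‖ ≤ ε := by
  have hc : ContinuousOn (fun z : ℂ => f z.re) (spectrum ℂ B) :=
    hf.comp Complex.continuous_re.continuousOn fun z hz => (spectrum_re_mem_Icc hB hB1 hz).2
  have := hB.isStarNormal
  rw [← cfc_polynomial P B, ← cfc_sub P.eval (fun z : ℂ => f z.re) B]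
  refine norm_cfc_le hε fun z hz => ?_
  obtain ⟨h1, h2⟩ := spectrum_re_mem_Icc hB hB1 hz
  have := h _ h2
  rwa [← h1] at this

/-- Matrix coefficients of `f(B)` from those of the Chebyshev polynomials of `B`. -/
theorem hasSum_chebyshevCoeff_mul {B : H →L[ℂ] H} (hB : IsSelfAdjoint B) (hB1 : ‖B‖ ≤ 1)
    {f : ℝ → ℂ} (hf : ContinuousOn f (Set.Icc (-1) 1)) (L : (H →L[ℂ] H) →L[ℂ] ℂ)
    (hL : Summable fun n : ℕ => ‖L (aeval B (U ℂ n))‖) :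
    HasSum (fun n : ℕ => chebyshevCoeff f n * L (aeval B (U ℂ n)))
      (L (cfc (fun z : ℂ => f z.re) B)) := by
  have hpc : ∀ P : ℂ[X], ContinuousOn (fun x : ℝ => P.eval (x : ℂ)) (Set.Icc (-1) 1) := fun P =>
    (P.continuous.comp Complex.continuous_ofReal).continuousOn
  -- For polynomials the expansion is a finite identity: it holds on each `U_m` by orthogonality and
  -- extends linearly.
  have hpoly : ∀ P : ℂ[X], HasSum
      (fun n : ℕ => chebyshevCoeff (fun x => P.eval (x : ℂ)) n * L (aeval B (U ℂ n)))
      (L (aeval B P)) := by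
    intro P
    have hP : P ∈ Submodule.span ℂ (Set.range fun n : ℕ => U ℂ n) := by
      rw [span_range_U]; trivial
    induction hP using Submodule.span_induction with
    | mem x h =>
      obtain ⟨m, rfl⟩ := h
      simp only [chebyshevCoeff_U]
      have h := hasSum_single (f := fun n : ℕ => (if n = m then 1 else 0) * L (aeval B (U ℂ n))) m
        fun k hk => by simp [hk]
      simpa using h
    | zero => simp [chebyshevCoeff]
    | add x y _ _ hx hy =>
      simp only [eval_add, map_add]
      convert! hx.add hy using 1
      ext n
      rw [chebyshevCoeff_add (hpc x) (hpc y), add_mul]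
    | smul c x _ hx =>
      simp only [eval_smul, map_smul, smul_eq_mul]
      convert! hx.mul_left c using 1
      ext n
      rw [chebyshevCoeff_const_mul, mul_assoc]
  obtain ⟨A, hA⟩ := isCompact_Icc.exists_bound_of_continuousOn hf
  have hsum : Summable fun n : ℕ => chebyshevCoeff f n * L (aeval B (U ℂ n)) := by
    refine Summable.of_norm_bounded (hL.mul_left (2 * A)) fun n => ?_
    rw [norm_mul]
    gcongr
    exact norm_chebyshevCoeff_le hA n
  set T : ℝ := ∑' n : ℕ, ‖L (aeval B (U ℂ n))‖ with hT
  have hT0 : 0 ≤ T := tsum_nonneg fun _ => norm_nonneg _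
  convert! hsum.hasSum using 1
  refine eq_of_forall_dist_le fun η hη => ?_
  -- Replacing `f` by a polynomial within `ε` moves the operator side by at most `‖L‖ ε` and the
  -- series by at most `2εT`, as each coefficient moves by at most `2ε`.
  set ε : ℝ := η / (‖L‖ + 2 * T + 1) with hε
  have hden : 0 < ‖L‖ + 2 * T + 1 := by positivity
  have hε0 : 0 < ε := by positivity
  obtain ⟨P, hP⟩ := exists_complex_polynomial_near hf hε0
  have h1 : ‖L (aeval B P) - L (cfc (fun z : ℂ => f z.re) B)‖ ≤ ‖L‖ * ε := by
    rw [← map_sub]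
    exact (L.le_opNorm _).trans (by gcongr; exact norm_cfc_sub_aeval_le hB hB1 hf hε0.le hP)
  have h2 : ‖L (aeval B P) - ∑' n : ℕ, chebyshevCoeff f n * L (aeval B (U ℂ n))‖ ≤
      2 * ε * T := by
    have h3 := (hpoly P).sub hsum.hasSum
    rw [← h3.tsum_eq]
    refine tsum_of_norm_bounded (hL.hasSum.mul_left (2 * ε)) fun n => ?_
    rw [← sub_mul, norm_mul]
    gcongr
    have h4 := chebyshevCoeff_add (f := fun x => P.eval (x : ℂ) - f x) (g := f)
      ((hpc P).sub hf) hf n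
    simp only [sub_add_cancel] at h4
    rw [h4, add_sub_cancel_right]
    exact norm_chebyshevCoeff_le hP n
  rw [dist_eq_norm]
  calc _ = ‖(L (aeval B P) - ∑' n : ℕ, chebyshevCoeff f n * L (aeval B (U ℂ n))) -
        (L (aeval B P) - L (cfc (fun z : ℂ => f z.re) B))‖ := by congr 1; ring
    _ ≤ 2 * ε * T + ‖L‖ * ε := (norm_sub_le _ _).trans (add_le_add h2 h1)
    _ ≤ (‖L‖ + 2 * T + 1) * ε := by linarith
    _ = η := by rw [hε]; field_simp

end Chebyshev

noncomputable section

/-! ### Adjacency operator of the tree: norm bound and kernels of `U_n` -/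

section Tree

variable {V : Type*} {G : SimpleGraph V}

/-- In a tree rooted at `o`, every vertex `x ≠ o` has a unique neighbour closer to `o`. -/
theorem SimpleGraph.IsTree.exists_parent (hG : G.IsTree) {o x : V} (hx : x ≠ o) :
    ∃ w, G.Adj x w ∧ G.dist o x = G.dist o w + 1 ∧
      ∀ z, G.Adj x z → z ≠ w → G.dist o z = G.dist o x + 1 := by
  obtain ⟨p, hp, hpl⟩ := hG.connected.exists_path_of_dist x o
  have hnil : ¬ p.Nil := fun h => hx h.eq
  -- A geodesic to `o` through any closer neighbour is a path, and a tree has only one path from `x`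
  -- to `o`.
  have huniq : ∀ z, G.Adj x z → G.dist o x = G.dist o z + 1 → z = p.snd := by
    intro z hz hd
    obtain ⟨q, hq⟩ := hG.connected.exists_walk_length_eq_dist z o
    have hpath : (SimpleGraph.Walk.cons hz q).IsPath := by
      refine SimpleGraph.Walk.isPath_of_length_eq_dist _ ?_
      rw [SimpleGraph.Walk.length_cons, hq, SimpleGraph.dist_comm, ← hd, SimpleGraph.dist_comm]
    have := (hG.existsUnique_path x o).unique hp hpath
    rw [this]
    simp
  have hadj : G.Adj x p.snd := p.adj_snd hnil
  refine ⟨p.snd, hadj, ?_, fun z hz hzw => ?_⟩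
  · rcases hG.dist_eq_dist_add_one_of_adj o hadj with h | h
    · exact h
    · exfalso
      have h1 := SimpleGraph.dist_le p.tail
      have h2 := SimpleGraph.Walk.length_tail_add_one hnil
      rw [SimpleGraph.dist_comm] at h1
      have h3 : G.dist x o = G.dist o x := SimpleGraph.dist_comm
      omega
  · rcases hG.dist_eq_dist_add_one_of_adj o hz with h | h
    · exact absurd (huniq z hz h) hzw
    · exact h

variable [G.LocallyFinite] {Q : ℕ}

theorem IsHomogeneousTree.sum_neighbor_dist [DecidableEq V] {R : Type*} [CommRing R] (hG : IsHomogeneousTree G Q)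
    (o x : V) (φ : ℕ → R) : ∑ z ∈ G.neighborFinset x, φ (G.dist o z) =
      if x = o then ((Q : R) + 1) * φ 1
      else φ (G.dist o x - 1) + Q * φ (G.dist o x + 1) := by
  have hcard : (G.neighborFinset x).card = Q + 1 := hG.regular x
  split_ifs with h
  · subst h
    rw [Finset.sum_congr rfl fun z hz => by
      rw [SimpleGraph.dist_eq_one_iff_adj.2 ((SimpleGraph.mem_neighborFinset _ _ _).1 hz)]]
    rw [Finset.sum_const, hcard, nsmul_eq_mul]
    push_cast
    ring
  · obtain ⟨w, hw, hd, hz⟩ := hG.isTree.exists_parent h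
    have hmem : w ∈ G.neighborFinset x := (SimpleGraph.mem_neighborFinset _ _ _).2 hw
    rw [← Finset.add_sum_erase _ _ hmem, Finset.sum_congr rfl fun z hz' => by
      rw [hz z ((SimpleGraph.mem_neighborFinset _ _ _).1 (Finset.mem_of_mem_erase hz'))
        (Finset.ne_of_mem_erase hz')], Finset.sum_const, Finset.card_erase_of_mem hmem, hcard,
      nsmul_eq_mul, hd]
    simp

/-- The weight `Q^{-d(o,x)/2}` is superharmonic at the bottom of the spectrum. -/
theorem IsHomogeneousTree.sum_neighbor_weight_le (hG : IsHomogeneousTree G Q) (hQ : 2 ≤ Q)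
    (o x : V) : ∑ z ∈ G.neighborFinset x, (√(Q : ℝ))⁻¹ ^ G.dist o z ≤
      2 * √(Q : ℝ) * (√(Q : ℝ))⁻¹ ^ G.dist o x := by
  classical
  have hQ' : (2 : ℝ) ≤ Q := by exact_mod_cast hQ
  set s := √(Q : ℝ) with hs
  have hs0 : 0 < s := Real.sqrt_pos.2 (by linarith)
  have hss : s * s = Q := Real.mul_self_sqrt (by linarith)
  rw [hG.sum_neighbor_dist o x fun d => s⁻¹ ^ d]
  -- At the root the claim is `Q + 1 ≤ 2Q`; elsewhere equality holds.
  split_ifs with h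
  · subst h
    rw [SimpleGraph.dist_self, pow_one, pow_zero, mul_one, mul_inv_le_iff₀ hs0]
    nlinarith
  · have hd : G.dist o x ≠ 0 := fun h0 => h (hG.isTree.connected.dist_eq_zero_iff.1 h0).symm
    obtain ⟨d, hd⟩ := Nat.exists_eq_succ_of_ne_zero hd
    rw [hd, ← hss]
    refine le_of_eq ?_
    simp only [Nat.succ_eq_add_one, Nat.add_sub_cancel]
    rw [pow_succ, pow_succ]
    field_simp
    ring

/-- **Schur test** for the adjacency operator with a positive weight. -/
theorem sum_norm_sum_neighbor_sq_le {c : ℝ} (h : V → ℝ) (hh : ∀ x, 0 < h x)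
    (hsup : ∀ x, ∑ z ∈ G.neighborFinset x, h z ≤ c * h x) (hc : 0 ≤ c) (f : ellp V 2)
    (s : Finset V) :
    ∑ x ∈ s, ‖∑ y ∈ G.neighborFinset x, f y‖ ^ 2 ≤ c ^ 2 * ‖f‖ ^ 2 := by
  classical
  have h1 : ∀ x, ‖∑ y ∈ G.neighborFinset x, f y‖ ^ 2 ≤
      c * h x * ∑ y ∈ G.neighborFinset x, ‖f y‖ ^ 2 / h y := by
    intro x
    calc ‖∑ y ∈ G.neighborFinset x, f y‖ ^ 2 ≤ (∑ y ∈ G.neighborFinset x, ‖f y‖) ^ 2 := by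
          gcongr
          exact norm_sum_le _ _
      -- Cauchy–Schwarz after writing `|f| = √h · (|f| / √h)`.
      _ ≤ (∑ y ∈ G.neighborFinset x, h y) * ∑ y ∈ G.neighborFinset x, ‖f y‖ ^ 2 / h y := by
          refine Finset.sum_sq_le_sum_mul_sum_of_sq_le_mul _ (fun y _ => (hh y).le)
            (fun y _ => div_nonneg (sq_nonneg _) (hh y).le) fun y _ => le_of_eq ?_
          have := (hh y).ne'
          field_simp
      _ ≤ _ := by
          gcongr
          · exact Finset.sum_nonneg fun y _ => div_nonneg (sq_nonneg _) (hh y).le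
          · exact hsup x
  set t : Finset V := s.biUnion fun x => G.neighborFinset x with ht
  have hnorm : ∑ y ∈ t, ‖f y‖ ^ 2 ≤ ‖f‖ ^ 2 := by
    have := lp.sum_rpow_le_norm_rpow (p := 2) (by norm_num) f t
    simpa using this
  calc ∑ x ∈ s, ‖∑ y ∈ G.neighborFinset x, f y‖ ^ 2
      ≤ ∑ x ∈ s, ∑ y ∈ G.neighborFinset x, c * (h x * (‖f y‖ ^ 2 / h y)) := by
        refine Finset.sum_le_sum fun x _ => (h1 x).trans (le_of_eq ?_)
        rw [Finset.mul_sum]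
        exact Finset.sum_congr rfl fun y _ => by ring
    _ = ∑ y ∈ t, ∑ x ∈ s.filter fun x => G.Adj x y, c * (h x * (‖f y‖ ^ 2 / h y)) := by
        refine Finset.sum_comm' fun x y => ?_
        simp only [ht, Finset.mem_biUnion, Finset.mem_filter, SimpleGraph.mem_neighborFinset]
        exact ⟨fun h => ⟨h, x, h⟩, fun h => h.1⟩
    _ ≤ ∑ y ∈ t, c ^ 2 * ‖f y‖ ^ 2 := by
        refine Finset.sum_le_sum fun y _ => ?_
        have h2 : ∑ x ∈ s.filter fun x => G.Adj x y, h x ≤ c * h y := by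
          refine le_trans ?_ (hsup y)
          refine Finset.sum_le_sum_of_subset_of_nonneg (fun x hx => ?_) fun x _ _ => (hh x).le
          rw [SimpleGraph.mem_neighborFinset]
          exact (Finset.mem_filter.1 hx).2.symm
        rw [← Finset.mul_sum, ← Finset.sum_mul]
        calc _ ≤ c * (c * h y * (‖f y‖ ^ 2 / h y)) := by
              have := (hh y).le
              gcongr
          _ = _ := by
              have := (hh y).ne'
              field_simp
    _ = c ^ 2 * ∑ y ∈ t, ‖f y‖ ^ 2 := by rw [Finset.mul_sum]
    _ ≤ _ := by gcongr

/-- The adjacency operator of `𝕋_Q`, divided by its norm bound `2 √Q`. -/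
def normalizedAdjacency (hG : IsHomogeneousTree G Q) : ellp V 2 →L[ℂ] ellp V 2 :=
  ((((Q : ℝ) + 1) / (2 * √(Q : ℝ)) : ℝ) : ℂ) • (1 + treeLaplacian hG)

theorem normalizedAdjacency_apply (hG : IsHomogeneousTree G Q) (f : ellp V 2) (x : V) :
    normalizedAdjacency hG f x =
      ((2 * √(Q : ℝ) : ℝ) : ℂ)⁻¹ * ∑ y ∈ G.neighborFinset x, f y := by
  have h : normalizedAdjacency hG f x = ((((Q : ℝ) + 1) / (2 * √(Q : ℝ)) : ℝ) : ℂ) *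
    (f x + treeLaplacian hG f x) := rfl
  have hQ : ((Q : ℂ) + 1) ≠ 0 := by exact_mod_cast Nat.succ_ne_zero Q
  rw [h, treeLaplacian_apply]
  push_cast
  rw [add_sub_cancel]
  rw [← mul_assoc, mul_one_div, div_right_comm, div_self hQ, one_div]

theorem isSelfAdjoint_normalizedAdjacency (hG : IsHomogeneousTree G Q) :
    IsSelfAdjoint (normalizedAdjacency hG) := by
  have h1 := (neg_treeLaplacian_isPositive hG).isSelfAdjoint
  have h2 := (IsSelfAdjoint.one (ellp V 2 →L[ℂ] ellp V 2)).sub h1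
  rw [sub_neg_eq_add] at h2
  refine IsSelfAdjoint.smul ?_ h2
  exact Complex.conj_ofReal _

/-- Schur test with the weight `Q^{-d(o,x)/2}`. The constant weight would only give `(Q+1)/(2√Q) >
1`, too weak to place the spectrum in `[-1,1]`. -/
theorem norm_normalizedAdjacency_le (hG : IsHomogeneousTree G Q) (hQ : 2 ≤ Q) :
    ‖normalizedAdjacency hG‖ ≤ 1 := by
  have hs0 : 0 < √(Q : ℝ) := Real.sqrt_pos.2 (by positivity)
  obtain ⟨o⟩ := hG.isTree.connected.nonempty
  refine ContinuousLinearMap.opNorm_le_bound _ zero_le_one fun f => ?_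
  rw [one_mul]
  refine lp.norm_le_of_forall_sum_le (by norm_num) (norm_nonneg f) fun s => ?_
  have h := sum_norm_sum_neighbor_sq_le (fun x => (√(Q : ℝ))⁻¹ ^ G.dist o x)
    (fun x => by positivity) (hG.sum_neighbor_weight_le hQ o) (by positivity) f s
  simp only [ENNReal.toReal_ofNat, Real.rpow_ofNat]
  calc ∑ x ∈ s, ‖normalizedAdjacency hG f x‖ ^ 2
      = ((2 * √(Q : ℝ)) ^ 2)⁻¹ * ∑ x ∈ s, ‖∑ y ∈ G.neighborFinset x, f y‖ ^ 2 := by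
        rw [Finset.mul_sum]
        refine Finset.sum_congr rfl fun x _ => ?_
        rw [normalizedAdjacency_apply, norm_mul, mul_pow, norm_inv, Complex.norm_real,
          Real.norm_of_nonneg (by positivity), inv_pow]
    _ ≤ ((2 * √(Q : ℝ)) ^ 2)⁻¹ * ((2 * √(Q : ℝ)) ^ 2 * ‖f‖ ^ 2) := by gcongr
    _ = ‖f‖ ^ 2 := by field_simp

theorem neg_treeLaplacian_eq (hG : IsHomogeneousTree G Q) (hQ : 2 ≤ Q) :
    -treeLaplacian hG = 1 - (((2 * √(Q : ℝ)) / ((Q : ℝ) + 1) : ℝ) : ℂ) •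
      normalizedAdjacency hG := by
  have hs0 : 0 < √(Q : ℝ) := Real.sqrt_pos.2 (by positivity)
  rw [normalizedAdjacency, smul_smul, ← Complex.ofReal_mul]
  rw [show 2 * √(Q : ℝ) / ((Q : ℝ) + 1) * (((Q : ℝ) + 1) / (2 * √(Q : ℝ))) = 1 by field_simp]
  rw [Complex.ofReal_one, one_smul]
  abel

open Polynomial in
/-- The kernel of `U_n` of the normalized adjacency operator. -/
theorem aeval_U_normalizedAdjacency_single [DecidableEq V] (hG : IsHomogeneousTree G Q)
    (hQ : 2 ≤ Q) (n : ℕ) (o x : V) :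
    aeval (normalizedAdjacency hG) (Chebyshev.U ℂ n) (lp.single 2 o (1 : ℂ)) x =
      (((√(Q : ℝ))⁻¹ ^ n * if G.dist o x ≤ n ∧ Even (G.dist o x + n) then 1 else 0 : ℝ) : ℂ) := by
  set B := normalizedAdjacency hG with hB
  set s := √(Q : ℝ) with hs
  have hs0 : 0 < s := Real.sqrt_pos.2 (by positivity)
  have hss : s * s = Q := Real.mul_self_sqrt (by positivity)
  -- The relations `e_{n+1}(d+1) = e_n(d)` and `e_{n+2}(0) = e_n(0)` make the outward terms of `2B
  -- U_{n+1}` cancel against `U_n`, leaving a single indicator.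
  set e : ℕ → ℕ → ℝ := fun n d => if d ≤ n ∧ Even (d + n) then 1 else 0 with he
  have e1 : ∀ n d, e (n + 1) (d + 1) = e n d := by
    intro n d
    simp only [he]
    congr 1
    simp only [Nat.add_le_add_iff_right, eq_iff_iff, and_congr_right_iff]
    intro _
    rw [show d + 1 + (n + 1) = d + n + 2 by ring, Nat.even_add]
    simp
  have e2 : ∀ n, e (n + 2) 0 = e n 0 := by
    intro n
    simp only [he]
    congr 1
    simp [Nat.even_add]
  have hzero : ∀ y, G.dist o y = 0 ↔ y = o := fun y =>
    hG.isTree.connected.dist_eq_zero_iff.trans eq_comm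
  have hBe : ∀ (f : ellp V 2) (k : ℕ) (r : ℝ), (∀ y, f y = ((r * e k (G.dist o y) : ℝ) : ℂ)) →
      ∀ y, 2 * (B f) y = ((s⁻¹ * r * (if y = o then ((Q : ℝ) + 1) * e k 1 else
        e k (G.dist o y - 1) + Q * e k (G.dist o y + 1)) : ℝ) : ℂ) := by
    intro f k r hf y
    rw [← hG.sum_neighbor_dist o y (e k), hB, normalizedAdjacency_apply]
    simp only [hf, ← hs]
    push_cast
    rw [← Finset.mul_sum]
    have : (s : ℂ) ≠ 0 := by exact_mod_cast hs0.ne'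
    field_simp
  have htwo : ∀ (T : ellp V 2 →L[ℂ] ellp V 2) (f : ellp V 2) (y : V),
      ((2 * T) f) y = 2 * (T f) y := by
    intro T f y
    rw [two_mul, two_mul]
    rfl
  -- Consecutive indices are carried together because the recurrence is of second order.
  suffices H : ∀ n : ℕ, (∀ y, aeval B (Chebyshev.U ℂ n) (lp.single 2 o (1 : ℂ)) y =
      ((s⁻¹ ^ n * e n (G.dist o y) : ℝ) : ℂ)) ∧
      (∀ y, aeval B (Chebyshev.U ℂ (n + 1)) (lp.single 2 o (1 : ℂ)) y =
      ((s⁻¹ ^ (n + 1) * e (n + 1) (G.dist o y) : ℝ) : ℂ)) from (H n).1 x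
  intro n
  induction n with
  | zero =>
    have h0 : ∀ y, aeval B (Chebyshev.U ℂ (0 : ℕ)) (lp.single 2 o (1 : ℂ)) y =
        ((s⁻¹ ^ 0 * e 0 (G.dist o y) : ℝ) : ℂ) := by
      intro y
      by_cases hy : y = o
      · subst hy
        simp [he]
      · have : G.dist o y ≠ 0 := fun h => hy ((hzero y).1 h)
        simp [he, this, hy]
    refine ⟨h0, fun y => ?_⟩
    have h1 := hBe (lp.single 2 o (1 : ℂ)) 0 1 (fun z => by simpa using h0 z) y
    have h2 : aeval B (Chebyshev.U ℂ ((0 : ℕ) + 1)) (lp.single 2 o (1 : ℂ)) y =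
        2 * (B (lp.single 2 o (1 : ℂ))) y := by
      rw [Nat.cast_zero, zero_add, Chebyshev.U_one, map_mul, aeval_X, map_ofNat, htwo]
    rw [h2, h1]
    congr 1
    by_cases hy : y = o
    · subst hy
      simp [he]
    · obtain ⟨d, hd⟩ := Nat.exists_eq_succ_of_ne_zero fun h => hy ((hzero y).1 h)
      rw [if_neg hy, hd, Nat.succ_eq_add_one, e1, Nat.add_sub_cancel]
      simp [he]
  | succ n ih =>
    refine ⟨by exact_mod_cast ih.2, fun y => ?_⟩
    have h1 := hBe _ (n + 1) _ ih.2 y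
    have h2 : aeval B (Chebyshev.U ℂ ((n + 1 : ℕ) + 1)) (lp.single 2 o (1 : ℂ)) y =
        2 * (B (aeval B (Chebyshev.U ℂ (n + 1)) (lp.single 2 o (1 : ℂ)))) y -
          aeval B (Chebyshev.U ℂ n) (lp.single 2 o (1 : ℂ)) y := by
      rw [show ((n + 1 : ℕ) : ℤ) + 1 = n + 2 by push_cast; ring, Chebyshev.U_add_two]
      simp only [map_sub, map_mul, aeval_X, map_ofNat, mul_assoc]
      rw [← htwo]
      rfl
    rw [h2, h1, ih.1, ← Complex.ofReal_sub]
    congr 1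
    by_cases hy : y = o
    · subst hy
      rw [if_pos rfl, SimpleGraph.dist_self, e2, e1, ← hss]
      simp only [inv_pow, pow_succ]
      field_simp
      ring
    · obtain ⟨d, hd⟩ := Nat.exists_eq_succ_of_ne_zero fun h => hy ((hzero y).1 h)
      rw [if_neg hy, hd, Nat.succ_eq_add_one, e1, e1, Nat.add_sub_cancel, ← hss]
      simp only [inv_pow, pow_succ]
      field_simp
      ring

end Tree

end

noncomputable section

/-! ### The phase `(1 - γ cos θ)^a` -/

section Phase

variable {γ a : ℝ}

theorem one_sub_mul_cos_pos (h0 : 0 < γ) (h1 : γ < 1) (θ : ℝ) : 0 < 1 - γ * Real.cos θ := by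
  nlinarith [Real.cos_le_one θ]

theorem one_sub_mul_pos (h0 : 0 < γ) (h1 : γ < 1) {x : ℝ} (hx : x ∈ Set.Icc (-1 : ℝ) 1) :
    0 < 1 - γ * x := by
  nlinarith [hx.2]

/-- Decay of the Chebyshev coefficients of `e^{it(1-γx)^a}`. -/
theorem exists_norm_chebyshevCoeff_le (h0 : 0 < γ) (h1 : γ < 1) (ha : 0 < a) :
    ∃ D : ℝ, 0 < D ∧ ∀ (n : ℕ) (t : ℝ),
      ‖chebyshevCoeff (fun x => Complex.exp (Complex.I * t * ((1 - γ * x) ^ a : ℝ))) n‖ ≤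
        D * (n + 1) ^ 2 * (1 + |t|) ^ (-(3 / 2) : ℝ) := by
  have hpos := one_sub_mul_cos_pos h0 h1
  -- This is the `p` for which the phase has derivative `sin θ / p`; it is smooth because `γ < 1`
  -- keeps the base positive.
  have hd : ContDiff ℝ 2 fun θ => (1 - γ * Real.cos θ) ^ (1 - a) / (a * γ) := by
    refine ContDiff.div_const ?_ _
    refine ContDiff.rpow_const_of_ne ?_ fun θ => (hpos θ).ne'
    exact contDiff_const.sub (contDiff_const.mul Real.contDiff_cos)
  have hΨ : ∀ θ, HasDerivAt (fun θ => (1 - γ * Real.cos θ) ^ a)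
      (Real.sin θ / ((1 - γ * Real.cos θ) ^ (1 - a) / (a * γ))) θ := by
    intro θ
    have h2 := ((((Real.hasDerivAt_cos θ).const_mul γ).const_sub 1).rpow_const (p := a)
      (Or.inl (hpos θ).ne'))
    refine h2.congr_deriv ?_
    have h3 : (1 - γ * Real.cos θ) ^ (a - 1) = ((1 - γ * Real.cos θ) ^ (1 - a))⁻¹ := by
      rw [← Real.rpow_neg (hpos θ).le, neg_sub]
    have h4 := (Real.rpow_pos_of_pos (hpos θ) (1 - a)).ne'
    rw [h3]
    field_simp
  obtain ⟨D, hD, h⟩ := exists_norm_integral_phase_sin_le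
    (fun θ => div_pos (Real.rpow_pos_of_pos (hpos θ) _) (mul_pos ha h0)) hd hΨ
  refine ⟨2 / Real.pi * D, by positivity, fun n t => ?_⟩
  have hn : ‖(2 / Real.pi : ℂ)‖ = 2 / Real.pi := by
    rw [norm_div, Complex.norm_real, Real.norm_of_nonneg Real.pi_pos.le]
    simp
  rw [chebyshevCoeff, norm_mul, hn]
  calc _ ≤ 2 / Real.pi * (D * (n + 1) ^ 2 * (1 + |t|) ^ (-(3 / 2) : ℝ)) := by
        gcongr
        exact h n t
    _ = _ := by ring

end Phase

/-! ### The Schrödinger group as a single function of `B` -/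

section FunctionalCalculus

variable {H : Type*} [NormedAddCommGroup H] [InnerProductSpace ℂ H] [CompleteSpace H]

theorem unitaryGroup_operatorPower_eq_cfc {B : H →L[ℂ] H} (hB : IsSelfAdjoint B) (hB1 : ‖B‖ ≤ 1)
    {γ a : ℝ} (h0 : 0 < γ) (h1 : γ < 1) (t : ℝ) :
    unitaryGroup (operatorPower (1 - (γ : ℂ) • B) a) t =
      cfc (fun z : ℂ => Complex.exp (Complex.I * t * ((1 - γ * z.re) ^ a : ℝ))) B := by
  have hn := hB.isStarNormal
  have hspec : ∀ x ∈ spectrum ℝ B, x ∈ Set.Icc (-1 : ℝ) 1 := by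
    intro x hx
    have : (x : ℂ) ∈ spectrum ℂ B := by
      rwa [← spectrum.preimage_algebraMap (R := ℝ) ℂ] at hx
    simpa using (spectrum_re_mem_Icc hB hB1 this).2
  have hA : (1 - (γ : ℂ) • B) = cfc (fun x : ℝ => 1 - γ * x) B := by
    rw [cfc_sub (fun _ : ℝ => (1 : ℝ)) (fun x : ℝ => γ * x) B, cfc_const_one ℝ B,
      cfc_const_mul_id γ B]
    rfl
  have hX : operatorPower (1 - (γ : ℂ) • B) a =
      cfc (fun z : ℂ => (((1 - γ * z.re) ^ a : ℝ) : ℂ)) B := by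
    rw [operatorPower, hA, ← cfc_comp' (fun s : ℝ => s ^ a) (fun x : ℝ => 1 - γ * x) B ?_ ?_ hB,
      cfc_real_eq_complex _ hB]
    · refine ContinuousOn.rpow_const continuousOn_id ?_
      rintro _ ⟨x, hx, rfl⟩
      exact Or.inl (one_sub_mul_pos h0 h1 (hspec x hx)).ne'
    · fun_prop
  have hc : ContinuousOn (fun z : ℂ => (((1 - γ * z.re) ^ a : ℝ) : ℂ)) (spectrum ℂ B) := by
    refine Complex.continuous_ofReal.comp_continuousOn (ContinuousOn.rpow_const (by fun_prop) ?_)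
    intro z hz
    exact Or.inl (one_sub_mul_pos h0 h1 (spectrum_re_mem_Icc hB hB1 hz).2).ne'
  have hc' : ContinuousOn (fun z : ℂ => Complex.I * t * (((1 - γ * z.re) ^ a : ℝ) : ℂ))
      (spectrum ℂ B) := continuousOn_const.mul hc
  rw [unitaryGroup, hX, ← cfc_const_mul (Complex.I * t) _ B hc,
    ← CFC.complex_exp_eq_normedSpace_exp (cfc_predicate _ _),
    ← cfc_comp' Complex.exp _ B Complex.continuous_exp.continuousOn hc' hn]

end FunctionalCalculus

/-! ### Interpolation for nonnegative kernels -/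

section Interpolation

variable {V : Type*}

/-- Riesz–Thorin interpolation for nonnegative kernels. -/
theorem sum_kernel_mul_mul_le {K : V → V → ℝ} {κ L : ℝ} {s t : Finset V}
    (hK0 : ∀ x y, 0 ≤ K x y) (hKκ : ∀ x y, K x y ≤ κ) (hκ : 0 ≤ κ) (hL : 0 ≤ L)
    (h2 : ∀ f g : V → ℝ, (∀ y, 0 ≤ f y) → (∀ x, 0 ≤ g x) →
      ∑ x ∈ s, ∑ y ∈ t, K x y * f y * g x ≤ L * √(∑ y ∈ t, f y ^ 2) * √(∑ x ∈ s, g x ^ 2))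
    {m p : ℝ} (hm : 2 < m) (hmp : m.HolderConjugate p) {f g : V → ℝ}
    (hf : ∀ y, 0 ≤ f y) (hg : ∀ x, 0 ≤ g x) :
    ∑ x ∈ s, ∑ y ∈ t, K x y * f y * g x ≤ κ ^ (1 - 2 / m) * L ^ (2 / m) *
      (∑ y ∈ t, f y ^ p) ^ (1 / p) * (∑ x ∈ s, g x ^ p) ^ (1 / p) := by
  have hm0 : 0 < m := by linarith
  have hp0 : 0 < p := hmp.symm.pos
  -- `1/m = (1-θ)·0 + θ/2`: the point between the `ℓ¹ → ℓ^∞` and `ℓ² → ℓ²` bounds.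
  set θ : ℝ := 2 / m with hθ
  have hθ0 : 0 < θ := by positivity
  have hθ1 : 0 < 1 - θ := by rw [hθ, sub_pos, div_lt_one hm0]; exact hm
  have hpθ : p * (1 - θ) + p / 2 * θ = 1 := by
    have : p * (1 - θ) + p / 2 * θ = p * (1 - m⁻¹) := by rw [hθ]; field_simp; ring
    rw [this, hmp.one_sub_inv, mul_inv_cancel₀ hp0.ne']
  have hsplit : ∀ u : ℝ, 0 ≤ u → u = (u ^ p) ^ (1 - θ) * (u ^ (p / 2)) ^ θ := by
    intro u hu
    rw [← Real.rpow_mul hu, ← Real.rpow_mul hu, ← Real.rpow_add_of_nonneg hu (by positivity)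
      (by positivity), hpθ, Real.rpow_one]
  have hKsplit : ∀ u : ℝ, 0 ≤ u → u = u ^ (1 - θ) * u ^ θ := by
    intro u hu
    rw [← Real.rpow_add_of_nonneg hu hθ1.le hθ0.le, sub_add_cancel, Real.rpow_one]
  set F : ℝ := ∑ y ∈ t, f y ^ p with hF
  set G : ℝ := ∑ x ∈ s, g x ^ p with hG
  have hF0 : 0 ≤ F := Finset.sum_nonneg fun y _ => Real.rpow_nonneg (hf y) _
  have hG0 : 0 ≤ G := Finset.sum_nonneg fun y _ => Real.rpow_nonneg (hg y) _
  -- By positivity, Hölder replaces complex interpolation: `K f g = A^(1-θ) B^θ` pointwise, where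
  -- `A` is summed by the sup bound on `K` and `B` by the `ℓ²` bound.
  set A : V × V → ℝ := fun z => K z.1 z.2 * f z.2 ^ p * g z.1 ^ p with hA
  set B : V × V → ℝ := fun z => K z.1 z.2 * f z.2 ^ (p / 2) * g z.1 ^ (p / 2) with hB
  have hA0 : ∀ z, 0 ≤ A z := fun z => mul_nonneg (mul_nonneg (hK0 _ _) (Real.rpow_nonneg (hf _) _))
    (Real.rpow_nonneg (hg _) _)
  have hB0 : ∀ z, 0 ≤ B z := fun z => mul_nonneg (mul_nonneg (hK0 _ _) (Real.rpow_nonneg (hf _) _))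
    (Real.rpow_nonneg (hg _) _)
  have hAB : ∀ z : V × V, K z.1 z.2 * f z.2 * g z.1 = A z ^ (1 - θ) * B z ^ θ := by
    intro z
    have e1 := hK0 z.1 z.2
    have e2 := Real.rpow_nonneg (hf z.2) p
    have e3 := Real.rpow_nonneg (hf z.2) (p / 2)
    have e4 := Real.rpow_nonneg (hg z.1) p
    have e5 := Real.rpow_nonneg (hg z.1) (p / 2)
    simp only [hA, hB]
    rw [Real.mul_rpow (mul_nonneg e1 e2) e4, Real.mul_rpow e1 e2,
      Real.mul_rpow (mul_nonneg e1 e3) e5, Real.mul_rpow e1 e3]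
    nth_rw 1 [hKsplit _ e1, hsplit _ (hf z.2), hsplit _ (hg z.1)]
    ring
  have hhol : (1 / (1 - θ)).HolderConjugate (1 / θ) := by
    rw [Real.holderConjugate_iff]
    refine ⟨?_, by simp⟩
    rw [lt_div_iff₀ hθ1]
    linarith
  have hH := Real.inner_le_Lp_mul_Lq_of_nonneg (s ×ˢ t) (f := fun z => A z ^ (1 - θ))
    (g := fun z => B z ^ θ) hhol (fun z _ => Real.rpow_nonneg (hA0 z) _)
    (fun z _ => Real.rpow_nonneg (hB0 z) _)
  have eA : ∀ z, (A z ^ (1 - θ)) ^ (1 / (1 - θ)) = A z := fun z => by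
    rw [← Real.rpow_mul (hA0 z), mul_one_div_cancel hθ1.ne', Real.rpow_one]
  have eB : ∀ z, (B z ^ θ) ^ (1 / θ) = B z := fun z => by
    rw [← Real.rpow_mul (hB0 z), mul_one_div_cancel hθ0.ne', Real.rpow_one]
  simp only [eA, eB, ← hAB, one_div_one_div] at hH
  rw [Finset.sum_product, Finset.sum_product, Finset.sum_product] at hH
  have bA : ∑ x ∈ s, ∑ y ∈ t, A (x, y) ≤ κ * F * G := by
    rw [hF, hG, Finset.mul_sum]
    refine Finset.sum_le_sum fun x _ => ?_
    rw [Finset.mul_sum, Finset.sum_mul]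
    refine Finset.sum_le_sum fun y _ => ?_
    exact mul_le_mul_of_nonneg_right (mul_le_mul_of_nonneg_right (hKκ x y)
      (Real.rpow_nonneg (hf y) _)) (Real.rpow_nonneg (hg x) _)
  have hsq : ∀ u : ℝ, 0 ≤ u → (u ^ (p / 2)) ^ 2 = u ^ p := fun u hu => by
    rw [← Real.rpow_natCast, ← Real.rpow_mul hu]
    norm_num
  have bB : ∑ x ∈ s, ∑ y ∈ t, B (x, y) ≤ L * F ^ (1 / 2 : ℝ) * G ^ (1 / 2 : ℝ) := by
    have := h2 (fun y => f y ^ (p / 2)) (fun x => g x ^ (p / 2))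
      (fun y => Real.rpow_nonneg (hf y) _) (fun x => Real.rpow_nonneg (hg x) _)
    rw [Finset.sum_congr rfl fun y _ => hsq _ (hf y), Finset.sum_congr rfl fun x _ => hsq _ (hg x),
      Real.sqrt_eq_rpow, Real.sqrt_eq_rpow] at this
    exact this
  have hexp : ∀ u : ℝ, 0 ≤ u → u ^ (1 - θ) * (u ^ (1 / 2 : ℝ)) ^ θ = u ^ (1 / p) := by
    intro u hu
    rw [← Real.rpow_mul hu, ← Real.rpow_add_of_nonneg hu hθ1.le (by positivity)]
    congr 1
    field_simp
    linarith
  calc ∑ x ∈ s, ∑ y ∈ t, K x y * f y * g x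
      ≤ (∑ x ∈ s, ∑ y ∈ t, A (x, y)) ^ (1 - θ) * (∑ x ∈ s, ∑ y ∈ t, B (x, y)) ^ θ := hH
    _ ≤ (κ * F * G) ^ (1 - θ) * (L * F ^ (1 / 2 : ℝ) * G ^ (1 / 2 : ℝ)) ^ θ := by
        have i1 : 0 ≤ ∑ x ∈ s, ∑ y ∈ t, A (x, y) :=
          Finset.sum_nonneg fun x _ => Finset.sum_nonneg fun y _ => hA0 _
        have i2 : 0 ≤ ∑ x ∈ s, ∑ y ∈ t, B (x, y) :=
          Finset.sum_nonneg fun x _ => Finset.sum_nonneg fun y _ => hB0 _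
        gcongr
    _ = κ ^ (1 - θ) * L ^ θ * F ^ (1 / p) * G ^ (1 / p) := by
        rw [Real.mul_rpow (by positivity) hG0, Real.mul_rpow hκ hF0,
          Real.mul_rpow (by positivity) (by positivity), Real.mul_rpow hL (by positivity),
          ← hexp F hF0, ← hexp G hG0]
        ring

theorem norm_sum_single_two [DecidableEq V] (f : V → ℂ) (t : Finset V) :
    ‖∑ y ∈ t, (lp.single 2 y (f y) : ellp V 2)‖ = √(∑ y ∈ t, ‖f y‖ ^ 2) := by
  have := lp.norm_sum_single (E := fun _ : V => ℂ) (p := 2) (by norm_num) f t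
  simp only [ENNReal.toReal_ofNat, Real.rpow_ofNat] at this
  rw [← this, Real.sqrt_sq (norm_nonneg _)]

theorem map_sum_single_apply [DecidableEq V] (T : ellp V 2 →L[ℂ] ellp V 2) (f : V → ℂ)
    (t : Finset V) (x : V) :
    T (∑ y ∈ t, lp.single 2 y (f y)) x = ∑ y ∈ t, f y * T (lp.single 2 y (1 : ℂ)) x := by
  rw [map_sum, lp.coeFn_sum, Finset.sum_apply]
  refine Finset.sum_congr rfl fun y _ => ?_
  have : (lp.single 2 y (f y) : ellp V 2) = f y • lp.single 2 y (1 : ℂ) := by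
    rw [← lp.single_smul, smul_eq_mul, mul_one]
  rw [this, map_smul]
  rfl

/-- Cauchy–Schwarz on finitely supported vectors; supplies the `ℓ²` hypothesis of
`sum_kernel_mul_mul_le`. -/
theorem sum_kernel_le_opNorm [DecidableEq V] (T : ellp V 2 →L[ℂ] ellp V 2) {K : V → V → ℝ}
    (hT : ∀ x y, T (lp.single 2 y (1 : ℂ)) x = (K x y : ℂ)) (s t : Finset V) (f g : V → ℝ)
    (hg : ∀ x, 0 ≤ g x) :
    ∑ x ∈ s, ∑ y ∈ t, K x y * f y * g x ≤ ‖T‖ * √(∑ y ∈ t, f y ^ 2) * √(∑ x ∈ s, g x ^ 2) := by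
  set v : ellp V 2 := ∑ y ∈ t, lp.single 2 y ((f y : ℝ) : ℂ) with hv
  have hvn : ‖v‖ = √(∑ y ∈ t, f y ^ 2) := by
    rw [hv, norm_sum_single_two fun y => ((f y : ℝ) : ℂ)]
    simp
  have hTv : ∀ x, ∑ y ∈ t, K x y * f y ≤ ‖T v x‖ := by
    intro x
    have : T v x = ((∑ y ∈ t, K x y * f y : ℝ) : ℂ) := by
      rw [hv, map_sum_single_apply T fun y => ((f y : ℝ) : ℂ)]
      push_cast
      exact Finset.sum_congr rfl fun y _ => by rw [hT, mul_comm]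
    rw [this, Complex.norm_real]
    exact le_abs_self _
  have hle : ∑ x ∈ s, ‖T v x‖ ^ 2 ≤ ‖T v‖ ^ 2 := by
    have := lp.sum_rpow_le_norm_rpow (p := 2) (by norm_num) (T v) s
    simpa using this
  calc ∑ x ∈ s, ∑ y ∈ t, K x y * f y * g x ≤ ∑ x ∈ s, ‖T v x‖ * g x := by
        refine Finset.sum_le_sum fun x _ => ?_
        rw [← Finset.sum_mul]
        exact mul_le_mul_of_nonneg_right (hTv x) (hg x)
    _ ≤ √(∑ x ∈ s, ‖T v x‖ ^ 2) * √(∑ x ∈ s, g x ^ 2) := Real.sum_mul_le_sqrt_mul_sqrt _ _ _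
    _ ≤ ‖T v‖ * √(∑ x ∈ s, g x ^ 2) := by
        gcongr
        exact Real.sqrt_le_iff.2 ⟨norm_nonneg _, hle⟩
    _ ≤ ‖T‖ * ‖v‖ * √(∑ x ∈ s, g x ^ 2) := by
        gcongr
        exact T.le_opNorm v
    _ = _ := by rw [hvn]

end Interpolation

end

noncomputable section

/-! ### The dispersive estimate -/

section Schrodinger

variable {V : Type*} {G : SimpleGraph V} [G.LocallyFinite] {Q : ℕ}

/-- The upper bound is `(√Q - 1)² > 0`: the spectral gap of the tree. -/
theorem two_mul_sqrt_div_mem_Ioo (hQ : 2 ≤ Q) :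
    0 < 2 * √(Q : ℝ) / ((Q : ℝ) + 1) ∧ 2 * √(Q : ℝ) / ((Q : ℝ) + 1) < 1 := by
  have hQ' : (2 : ℝ) ≤ Q := by exact_mod_cast hQ
  have hs0 : 0 < √(Q : ℝ) := Real.sqrt_pos.2 (by linarith)
  have hss : √(Q : ℝ) * √(Q : ℝ) = Q := Real.mul_self_sqrt (by linarith)
  refine ⟨by positivity, ?_⟩
  rw [div_lt_one (by linarith)]
  have : √(Q : ℝ) ≠ 1 := fun h => by rw [h] at hss; linarith
  nlinarith [sq_pos_of_ne_zero (sub_ne_zero.2 this)]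

theorem schrodinger_eq_cfc (hG : IsHomogeneousTree G Q) (hQ : 2 ≤ Q) (α t : ℝ) :
    schrodinger hG α t = cfc (fun z : ℂ => Complex.exp (Complex.I * t *
      ((1 - 2 * √(Q : ℝ) / ((Q : ℝ) + 1) * z.re) ^ (α / 2) : ℝ))) (normalizedAdjacency hG) := by
  obtain ⟨h0, h1⟩ := two_mul_sqrt_div_mem_Ioo hQ
  rw [schrodinger, fracLaplacian, neg_treeLaplacian_eq hG hQ]
  exact unitaryGroup_operatorPower_eq_cfc (isSelfAdjoint_normalizedAdjacency hG)
    (norm_normalizedAdjacency_le hG hQ) h0 h1 t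

/-- The kernel of `U_n` of the normalized adjacency operator of `𝕋_Q`. -/
def chebyshevKernel (G : SimpleGraph V) (Q n : ℕ) (x y : V) : ℝ :=
  (√(Q : ℝ))⁻¹ ^ n * if G.dist y x ≤ n ∧ Even (G.dist y x + n) then 1 else 0

theorem chebyshevKernel_nonneg (G : SimpleGraph V) (Q n : ℕ) (x y : V) :
    0 ≤ chebyshevKernel G Q n x y := by
  unfold chebyshevKernel
  positivity

theorem chebyshevKernel_le (G : SimpleGraph V) (Q n : ℕ) (x y : V) :
    chebyshevKernel G Q n x y ≤ (√(Q : ℝ))⁻¹ ^ n := by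
  unfold chebyshevKernel
  refine mul_le_of_le_one_right (by positivity) ?_
  split_ifs <;> norm_num

/-- Interpolates between the sup bound `Q^(-n/2)` and the `ℓ²` bound `n + 1`. The ratio
`Q^(-(1-2/m)/2)` is below 1 exactly because `m > 2`, which is what makes the Chebyshev series
summable. -/
theorem sum_chebyshevKernel_le (hG : IsHomogeneousTree G Q) (hQ : 2 ≤ Q) (n : ℕ)
    {m p : ℝ} (hm : 2 < m) (hmp : m.HolderConjugate p) {f g : V → ℝ}
    (hf : ∀ y, 0 ≤ f y) (hg : ∀ x, 0 ≤ g x) (s t : Finset V) :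
    ∑ x ∈ s, ∑ y ∈ t, chebyshevKernel G Q n x y * f y * g x ≤
      (n + 1) * ((√(Q : ℝ))⁻¹ ^ (1 - 2 / m)) ^ n *
        (∑ y ∈ t, f y ^ p) ^ (1 / p) * (∑ x ∈ s, g x ^ p) ^ (1 / p) := by
  classical
  have hm0 : 0 < m := by linarith
  have hF0 : 0 ≤ ∑ y ∈ t, f y ^ p := Finset.sum_nonneg fun y _ => Real.rpow_nonneg (hf y) _
  have hG0 : 0 ≤ ∑ x ∈ s, g x ^ p := Finset.sum_nonneg fun y _ => Real.rpow_nonneg (hg y) _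
  refine (sum_kernel_mul_mul_le (κ := (√(Q : ℝ))⁻¹ ^ n) (L := n + 1)
    (chebyshevKernel_nonneg G Q n) (chebyshevKernel_le G Q n) (by positivity) (by positivity)
    (fun f g _ hg => ?_) hm hmp hf hg).trans ?_
  · refine (sum_kernel_le_opNorm _
      (fun x y => aeval_U_normalizedAdjacency_single hG hQ n y x) s t f g hg).trans ?_
    gcongr
    exact norm_aeval_U_le (isSelfAdjoint_normalizedAdjacency hG)
      (norm_normalizedAdjacency_le hG hQ) n
  · have e1 : ((√(Q : ℝ))⁻¹ ^ n) ^ (1 - 2 / m) = ((√(Q : ℝ))⁻¹ ^ (1 - 2 / m)) ^ n := by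
      rw [← Real.rpow_natCast, ← Real.rpow_mul (by positivity), mul_comm,
        Real.rpow_mul (by positivity), Real.rpow_natCast]
    have e2 : ((n : ℝ) + 1) ^ (2 / m) ≤ n + 1 := by
      have h1 : (1 : ℝ) ≤ n + 1 := by linarith [n.cast_nonneg (α := ℝ)]
      have := Real.rpow_le_rpow_of_exponent_le h1 (y := 2 / m) (z := 1)
        ((div_le_one hm0).2 hm.le)
      rwa [Real.rpow_one] at this
    rw [e1, mul_comm (((√(Q : ℝ))⁻¹ ^ (1 - 2 / m)) ^ n)]
    gcongr

/-- Bilinear form of the dispersive estimate on finitely supported functions. -/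
theorem exists_sum_norm_schrodinger_single_le (Q : ℕ) (hQ : 2 ≤ Q) (α : ℝ) (hα : 0 < α)
    {m p : ℝ} (hm : 2 < m) (hmp : m.HolderConjugate p) :
    ∃ C : ℝ, 0 < C ∧ ∀ (V : Type*) [DecidableEq V] (G : SimpleGraph V) [G.LocallyFinite]
      (hG : IsHomogeneousTree G Q) (τ : ℝ) (f g : V → ℝ), (∀ y, 0 ≤ f y) → (∀ x, 0 ≤ g x) →
      ∀ s t : Finset V,
        ∑ x ∈ s, ∑ y ∈ t, ‖schrodinger hG α τ (lp.single 2 y (1 : ℂ)) x‖ * f y * g x ≤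
          C * (1 + |τ|) ^ (-(3 / 2) : ℝ) *
            (∑ y ∈ t, f y ^ p) ^ (1 / p) * (∑ x ∈ s, g x ^ p) ^ (1 / p) := by
  have hm0 : 0 < m := by linarith
  obtain ⟨h0, h1⟩ := two_mul_sqrt_div_mem_Ioo hQ
  set γ : ℝ := 2 * √(Q : ℝ) / ((Q : ℝ) + 1) with hγ
  obtain ⟨D, hD, hcoef⟩ := exists_norm_chebyshevCoeff_le h0 h1 (half_pos hα)
  have hs1 : 1 < √(Q : ℝ) := by
    rw [Real.lt_sqrt zero_le_one]
    have : (2 : ℝ) ≤ Q := by exact_mod_cast hQ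
    linarith
  have hi1 : (√(Q : ℝ))⁻¹ < 1 := inv_lt_one_of_one_lt₀ hs1
  have hi0 : 0 < (√(Q : ℝ))⁻¹ := by positivity
  set ρ : ℝ := (√(Q : ℝ))⁻¹ ^ (1 - 2 / m) with hρ
  have hρ0 : 0 < ρ := Real.rpow_pos_of_pos hi0 _
  have hρ1 : ρ < 1 := by
    refine Real.rpow_lt_one hi0.le hi1 ?_
    rw [sub_pos, div_lt_one hm0]
    exact hm
  have hpoly : ∀ (k : ℕ) {r : ℝ}, 0 < r → r < 1 →
      Summable fun n : ℕ => ((n : ℝ) + 1) ^ k * r ^ n := by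
    intro k r hr0 hr1
    have h := summable_pow_mul_geometric_of_norm_lt_one (R := ℝ) k (r := r)
      (by rwa [Real.norm_of_nonneg hr0.le])
    have h' := ((summable_nat_add_iff 1).2 h).mul_left r⁻¹
    refine h'.congr fun n => ?_
    push_cast
    rw [pow_succ]
    field_simp
  -- Two powers of `n + 1` come from the coefficients and one from the `ℓ²` norm of `U_n`.
  have hS := hpoly 3 hρ0 hρ1
  set Z : ℝ := ∑' n : ℕ, ((n : ℝ) + 1) ^ 3 * ρ ^ n with hZ
  have hZ0 : 0 ≤ Z := tsum_nonneg fun n => by positivity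
  -- The constant is fixed before the tree; the `+ 1` only secures strict positivity.
  refine ⟨D * Z + 1, by positivity, ?_⟩
  intro V _ G _ hG τ f g hf hg s t
  set B := normalizedAdjacency hG with hB
  set T : ℝ := (1 + |τ|) ^ (-(3 / 2) : ℝ) with hT
  have hT0 : 0 ≤ T := by positivity
  set F : ℝ := (∑ y ∈ t, f y ^ p) ^ (1 / p) with hF
  set Γ : ℝ := (∑ x ∈ s, g x ^ p) ^ (1 / p) with hΓ
  have hF0 : 0 ≤ F := Real.rpow_nonneg
    (Finset.sum_nonneg fun y _ => Real.rpow_nonneg (hf y) _) _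
  have hΓ0 : 0 ≤ Γ := Real.rpow_nonneg
    (Finset.sum_nonneg fun y _ => Real.rpow_nonneg (hg y) _) _
  set φ : ℝ → ℂ := fun x => Complex.exp (Complex.I * τ * ((1 - γ * x) ^ (α / 2) : ℝ)) with hφ
  have hφc : ContinuousOn φ (Set.Icc (-1) 1) := by
    refine Complex.continuous_exp.comp_continuousOn (continuousOn_const.mul
      (Complex.continuous_ofReal.comp_continuousOn (ContinuousOn.rpow_const (by fun_prop) ?_)))
    exact fun x hx => Or.inl (one_sub_mul_pos h0 h1 hx).ne'
  set K := chebyshevKernel G Q with hK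
  have hKn := chebyshevKernel_nonneg G Q
  have hsumK : ∀ x y, Summable fun n : ℕ => D * ((n : ℝ) + 1) ^ 2 * T * K n x y := by
    intro x y
    refine Summable.of_nonneg_of_le (fun n => mul_nonneg (by positivity) (hKn n x y)) (fun n => ?_)
      ((hpoly 2 hi0 hi1).mul_left (D * T))
    calc _ ≤ D * ((n : ℝ) + 1) ^ 2 * T * (√(Q : ℝ))⁻¹ ^ n := by
          gcongr
          exact chebyshevKernel_le G Q n x y
      _ = _ := by ring
  have hentry : ∀ x y, ‖schrodinger hG α τ (lp.single 2 y (1 : ℂ)) x‖ ≤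
      ∑' n : ℕ, D * ((n : ℝ) + 1) ^ 2 * T * K n x y := by
    intro x y
    -- The expansion is used one matrix entry at a time: entries of `U_n(B)` decay like `Q^(-n/2)`,
    -- which gives the summability required of `L`.
    set L : (ellp V 2 →L[ℂ] ellp V 2) →L[ℂ] ℂ :=
      (lp.evalCLM ℂ (fun _ : V => ℂ) 2 x) ∘L
        (ContinuousLinearMap.apply ℂ (ellp V 2) (lp.single 2 y (1 : ℂ))) with hL
    have hLU : ∀ n : ℕ, L (Polynomial.aeval B (Polynomial.Chebyshev.U ℂ n)) = (K n x y : ℂ) :=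
      fun n => aeval_U_normalizedAdjacency_single hG hQ n y x
    have hsum := hasSum_chebyshevCoeff_mul (isSelfAdjoint_normalizedAdjacency hG)
      (norm_normalizedAdjacency_le hG hQ) hφc L (by
        simp only [← hB, hLU, Complex.norm_real]
        refine Summable.of_nonneg_of_le (fun n => norm_nonneg _) (fun n => ?_)
          (summable_geometric_of_lt_one hi0.le hi1)
        rw [Real.norm_of_nonneg (hKn n x y)]
        exact chebyshevKernel_le G Q n x y)
    have hval : L (cfc (fun z : ℂ => φ z.re) B) =
        schrodinger hG α τ (lp.single 2 y (1 : ℂ)) x := by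
      rw [schrodinger_eq_cfc hG hQ]
      rfl
    rw [← hval, ← hsum.tsum_eq]
    refine tsum_of_norm_bounded (hsumK x y).hasSum fun n => ?_
    rw [← hB, hLU, norm_mul, Complex.norm_real, Real.norm_of_nonneg (hKn n x y)]
    exact mul_le_mul_of_nonneg_right (hcoef n τ) (hKn n x y)
  have hbig : HasSum (fun n : ℕ => ∑ x ∈ s, ∑ y ∈ t,
      D * ((n : ℝ) + 1) ^ 2 * T * K n x y * f y * g x)
      (∑ x ∈ s, ∑ y ∈ t, (∑' n : ℕ, D * ((n : ℝ) + 1) ^ 2 * T * K n x y) * f y * g x) :=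
    hasSum_sum fun x _ => hasSum_sum fun y _ =>
      ((hsumK x y).hasSum.mul_right (f y)).mul_right (g x)
  have hbound := hS.hasSum.mul_left (D * T * F * Γ)
  calc ∑ x ∈ s, ∑ y ∈ t, ‖schrodinger hG α τ (lp.single 2 y (1 : ℂ)) x‖ * f y * g x
      ≤ ∑ x ∈ s, ∑ y ∈ t, (∑' n : ℕ, D * ((n : ℝ) + 1) ^ 2 * T * K n x y) * f y * g x := by
        refine Finset.sum_le_sum fun x _ => Finset.sum_le_sum fun y _ => ?_
        exact mul_le_mul_of_nonneg_right
          (mul_le_mul_of_nonneg_right (hentry x y) (hf y)) (hg x)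
    _ ≤ D * T * F * Γ * Z := by
        refine hasSum_le (fun n => ?_) hbig hbound
        calc _ = D * ((n : ℝ) + 1) ^ 2 * T * ∑ x ∈ s, ∑ y ∈ t, K n x y * f y * g x := by
              simp only [Finset.mul_sum]
              exact Finset.sum_congr rfl fun x _ => Finset.sum_congr rfl fun y _ => by ring
          _ ≤ D * ((n : ℝ) + 1) ^ 2 * T * ((n + 1) * ρ ^ n * F * Γ) := by
              gcongr
              exact sum_chebyshevKernel_le hG hQ n hm hmp hf hg s t
          _ = _ := by ring
    _ = D * Z * (T * F * Γ) := by ring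
    _ ≤ (D * Z + 1) * (T * F * Γ) := by
        gcongr
        linarith
    _ = _ := by ring

/-- Passage from bilinear estimates on finitely supported functions to `ℓ^p → ℓ^m` estimates. -/
theorem sum_norm_rpow_le_of_bilinear [DecidableEq V] (S : ellp V 2 →L[ℂ] ellp V 2) {C m p : ℝ}
    (hC : 0 ≤ C) (hmp : m.HolderConjugate p)
    (h : ∀ f g : V → ℝ, (∀ y, 0 ≤ f y) → (∀ x, 0 ≤ g x) → ∀ s t : Finset V,
      ∑ x ∈ s, ∑ y ∈ t, ‖S (lp.single 2 y (1 : ℂ)) x‖ * f y * g x ≤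
        C * (∑ y ∈ t, f y ^ p) ^ (1 / p) * (∑ x ∈ s, g x ^ p) ^ (1 / p))
    (f : ellp V 2) {A : ℝ} (hA : 0 ≤ A) (hf : ∀ t : Finset V, ∑ y ∈ t, ‖f y‖ ^ p ≤ A ^ p)
    (s : Finset V) : ∑ x ∈ s, ‖S f x‖ ^ m ≤ (C * A) ^ m := by
  have hm0 : 0 < m := hmp.pos
  have hp0 : 0 < p := hmp.symm.pos
  have hfin : ∀ t : Finset V,
      ∑ x ∈ s, ‖S (∑ y ∈ t, lp.single 2 y (f y)) x‖ ^ m ≤ (C * A) ^ m := by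
    intro t
    set v : ellp V 2 := ∑ y ∈ t, lp.single 2 y (f y) with hv
    -- Duality: `g` in the unit ball of `ℓ^p` attains the `ℓ^m` norm on `s`.
    obtain ⟨g, hg, hge⟩ := (NNReal.isGreatest_Lp s (fun x => ‖S v x‖₊) hmp).1
    have hge' : ∑ x ∈ s, ‖S v x‖ * (g x : ℝ) = (∑ x ∈ s, ‖S v x‖ ^ m) ^ (1 / m) := by
      have := congrArg NNReal.toReal hge
      simpa using this
    have hg' : ∑ x ∈ s, (g x : ℝ) ^ p ≤ 1 := by exact_mod_cast hg
    have hkey : (∑ x ∈ s, ‖S v x‖ ^ m) ^ (1 / m) ≤ C * A := by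
      rw [← hge']
      calc ∑ x ∈ s, ‖S v x‖ * (g x : ℝ)
          ≤ ∑ x ∈ s, ∑ y ∈ t, ‖S (lp.single 2 y (1 : ℂ)) x‖ * ‖f y‖ * g x := by
            refine Finset.sum_le_sum fun x _ => ?_
            rw [← Finset.sum_mul]
            gcongr
            rw [hv, map_sum_single_apply]
            refine (norm_sum_le _ _).trans (le_of_eq ?_)
            exact Finset.sum_congr rfl fun y _ => by rw [norm_mul, mul_comm]
        _ ≤ C * (∑ y ∈ t, ‖f y‖ ^ p) ^ (1 / p) * (∑ x ∈ s, (g x : ℝ) ^ p) ^ (1 / p) :=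
            h (fun y => ‖f y‖) (fun x => g x) (fun y => norm_nonneg _) (fun x => (g x).2) s t
        _ ≤ C * (A ^ p) ^ (1 / p) * 1 := by
            have i0 : 0 ≤ ∑ x ∈ s, (g x : ℝ) ^ p :=
              Finset.sum_nonneg fun x _ => Real.rpow_nonneg (g x).2 _
            gcongr
            · exact hf t
            · exact Real.rpow_le_one i0 hg' (by positivity)
        _ = C * A := by
            rw [← Real.rpow_mul hA, mul_one_div_cancel hp0.ne', Real.rpow_one, mul_one]
    have i1 : 0 ≤ ∑ x ∈ s, ‖S v x‖ ^ m :=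
      Finset.sum_nonneg fun x _ => Real.rpow_nonneg (norm_nonneg _) _
    have := Real.rpow_le_rpow (Real.rpow_nonneg i1 _) hkey hm0.le
    rwa [← Real.rpow_mul i1, one_div_mul_cancel hm0.ne', Real.rpow_one] at this
  -- Truncations of `f` converge in `ℓ²`, hence their images converge at each vertex; `s` is finite,
  -- so the bound passes to the limit.
  have hlim : Filter.Tendsto (fun t : Finset V => ∑ y ∈ t, lp.single 2 y (f y)) Filter.atTop
      (nhds f) := lp.hasSum_single (by norm_num) f
  refine le_of_tendsto (f := fun t : Finset V =>
    ∑ x ∈ s, ‖S (∑ y ∈ t, lp.single 2 y (f y)) x‖ ^ m) (x := Filter.atTop) ?_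
    (Filter.Eventually.of_forall hfin)
  refine tendsto_finsetSum _ fun x _ => ?_
  have h1 : Filter.Tendsto (fun t : Finset V => S (∑ y ∈ t, lp.single 2 y (f y)) x) Filter.atTop
      (nhds (S f x)) :=
    ((lp.evalCLM ℂ (fun _ : V => ℂ) 2 x ∘L S).continuous.tendsto f).comp hlim
  exact h1.norm.rpow_const (Or.inr hm0.le)

theorem dualExponent_le_of_le {q q' m p : ℝ≥0∞} (hqq' : q.HolderConjugate q')
    (hmp : m.HolderConjugate p) (h : m ≤ q) : q' ≤ p := by
  have h1 := (ENNReal.holderConjugate_iff.1 hqq')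
  have h2 := (ENNReal.holderConjugate_iff.1 hmp)
  by_contra! hlt
  have h3 : q'⁻¹ < p⁻¹ := ENNReal.inv_lt_inv.2 hlt
  have h4 : q⁻¹ ≤ m⁻¹ := ENNReal.inv_le_inv.2 h
  have hq : q⁻¹ ≠ ∞ := fun hq => by simp [hq] at h1
  have h5 := ENNReal.add_lt_add_of_le_of_lt hq h4 h3
  rw [h1, h2] at h5
  exact lt_irrefl _ h5

/-- The operator factors as `ℓ^{q'} ⊆ ℓ^p → ℓ^m ⊆ ℓ^r`, and both inclusions are contractions. -/
theorem norm_schrodingerOfLE_le (hG : IsHomogeneousTree G Q) {α t C m p : ℝ} {q' r : ℝ≥0∞}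
    [Fact (1 ≤ q')] [Fact (1 ≤ r)] (hq' : q' ≤ 2) (hr : 2 ≤ r) (hm : 2 ≤ m)
    (hmp : m.HolderConjugate p) (hq'p : q' ≤ ENNReal.ofReal p) (hmr : ENNReal.ofReal m ≤ r)
    (hC : 0 ≤ C)
    (h : ∀ (f : ellp V 2) (A : ℝ), 0 ≤ A → (∀ u : Finset V, ∑ y ∈ u, ‖f y‖ ^ p ≤ A ^ p) →
      ∀ s : Finset V, ∑ x ∈ s, ‖schrodinger hG α t f x‖ ^ m ≤ (C * A) ^ m) :
    ‖schrodingerOfLE hG α t hq' hr‖ ≤ C := by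
  have hm0 : 0 < m := by linarith
  have hp0 : 0 < p := hmp.symm.pos
  have : Fact (1 ≤ ENNReal.ofReal p) := ⟨ENNReal.one_le_ofReal.2 hmp.symm.lt.le⟩
  have : Fact (1 ≤ ENNReal.ofReal m) := ⟨ENNReal.one_le_ofReal.2 hmp.lt.le⟩
  have h2m : (2 : ℝ≥0∞) ≤ ENNReal.ofReal m := by
    rw [← ENNReal.ofReal_ofNat]
    exact ENNReal.ofReal_le_ofReal hm
  refine ContinuousLinearMap.opNorm_le_bound _ hC fun f => ?_
  set f₂ : ellp V 2 := ellpInclusion V hq' f with hf₂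
  set fp : ellp V (ENNReal.ofReal p) := lp.linearMapOfLE ℂ (fun _ : V => ℂ) hq'p f with hfp
  have hfpn : ‖fp‖ ≤ ‖f‖ := by simpa using norm_lp_le_of_exponent_le hq'p f
  set g : ellp V 2 := schrodinger hG α t f₂ with hg
  have hA : ∀ u : Finset V, ∑ y ∈ u, ‖f₂ y‖ ^ p ≤ ‖f‖ ^ p := by
    intro u
    have h1 := lp.sum_rpow_le_norm_rpow (p := ENNReal.ofReal p)
      (by rwa [ENNReal.toReal_ofReal hp0.le]) fp u
    rw [ENNReal.toReal_ofReal hp0.le] at h1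
    exact h1.trans (by gcongr)
  set gm : ellp V (ENNReal.ofReal m) := lp.linearMapOfLE ℂ (fun _ : V => ℂ) h2m g with hgm
  have hgmn : ‖gm‖ ≤ C * ‖f‖ := by
    refine lp.norm_le_of_forall_sum_le (by rwa [ENNReal.toReal_ofReal hm0.le]) (by positivity)
      fun s => ?_
    rw [ENNReal.toReal_ofReal hm0.le]
    exact h f₂ ‖f‖ (norm_nonneg _) hA s
  have hgr : schrodingerOfLE hG α t hq' hr f = lp.linearMapOfLE ℂ (fun _ : V => ℂ) hmr gm := by
    ext x
    rfl
  rw [hgr]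
  have := norm_lp_le_of_exponent_le hmr gm
  linarith

end Schrodinger

end

theorem mainTheorem7 (Q : ℕ) (hQ : 2 ≤ Q) (α : ℝ) (hα0 : 0 < α) (hα2 : α ≤ 2)
    (q q' r : ℝ≥0∞) [Fact (1 ≤ q')] [Fact (1 ≤ r)] (hqq' : q.HolderConjugate q')
    (hq : 2 < q) (hr : 2 < r) :
    ∃ C : ℝ, 0 < C ∧
      ∀ (V : Type*) (G : SimpleGraph V) [G.LocallyFinite] (hG : IsHomogeneousTree G Q) (t : ℝ),
        t ≠ 0 →
          ‖schrodingerOfLE hG α t (dualExponent_le_two hqq' hq) hr.le‖ ≤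
            C * (1 + |t|) ^ (-(3 / 2) : ℝ) := by
  -- A finite `m` strictly above 2 and below both exponents handles `q ≠ r` and infinite exponents
  -- at once.
  obtain ⟨m, hm2, hmqr⟩ := ENNReal.lt_iff_exists_nnreal_btwn.1 (lt_min hq hr)
  have hm : (2 : ℝ) < m := by exact_mod_cast hm2
  have hmp := Real.HolderConjugate.conjExponent (p := (m : ℝ)) (by linarith)
  have hmE : ENNReal.ofReal (m : ℝ) = m := ENNReal.ofReal_coe_nnreal
  obtain ⟨C, hC, h⟩ := exists_sum_norm_schrodinger_single_le Q hQ α hα0 hm hmp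
  refine ⟨C, hC, fun V G _ hG t _ => ?_⟩
  classical
  refine norm_schrodingerOfLE_le hG _ _ hm.le hmp
    (dualExponent_le_of_le hqq' hmp.ennrealOfReal ?_) ?_ (by positivity)
    fun f A hA hf s => sum_norm_rpow_le_of_bilinear _ (by positivity) hmp
      (fun f g hf hg s t' => h V G hG t f g hf hg s t') f hA hf s
  · rw [hmE]
    exact hmqr.le.trans (min_le_left _ _)
  · rw [hmE]
    exact hmqr.le.trans (min_le_right _ _)
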